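/- **Setting.** Let $\mathcal X,\mathcal Y$ be finite alphabets, $P$ a probability distribution on $\mathcal X$, $W(y\,|\,x)$ transition probabilities from $\mathcal X$ to $\mathcal Y$, and $R,K>0$ real numbers. For each block length $n$, generate a random codebook of $\lfloor e^{nR}\rfloor$ codewords $\mathbf x_m\in\mathcal X^n$, one for each message $m$, all letters being drawn i.i.d. from $P$. Given the codebook, generate for each message $m$ a cloud of $\lfloor e^{nK}\rfloor$ (not necessarily distinct) vectors $\mathbf y\in\mathcal Y^n$, all conditionally independent given the codebook, where the letters of a vector in the cloud of $m$ are independent and its $i$-th letter has the distribution $W(\cdot\,|\,x_{m i})$. These clouds form a channel instance. A message $m$ is chosen uniformly from the $\lfloor e^{nR}\rfloor$ messages, and the channel outputs a vector $\widehat{\mathbf y}$ chosen uniformly from the $\lfloor e^{nK}\rfloor$ (counted with multiplicity) vectors in the cloud of $m$. The maximum-likelihood decoder knows the codebook and all the clouds and outputs a message whose cloud contains the largest number of replicas of $\widehat{\mathbf y}$, with an arbitrary (possibly randomized) rule for breaking ties. Let $\overline P_e^{(n)}$ be its error probability averaged over messages, channel outputs, codebooks and channel instances. For probability distributions $T$ on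 $\mathcal Y$ and conditional distributions $V(x\,|\,y)$ on $\mathcal X$ given $y\in\mathcal Y$, let $$A_{TV}=D(V\,\|\,P\,|\,T)=\sum_{x,y}T(y)V(x\,|\,y)\log\frac{V(x\,|\,y)}{P(x)},\qquad B_{TV}=\mathbb E_{TV}\big[-\log W(Y\,|\,X)\big],$$ $$D(TV\,\|\,PW)=\sum_{x,y}T(y)V(x\,|\,y)\log\frac{T(y)V(x\,|\,y)}{P(x)W(y\,|\,x)},$$ where logarithms are natural and, for each of the three quantities, terms with $T(y)V(x\,|\,y)=0$ are zero and the value is $+\infty$ if a denominator (or, in $B_{TV}$, the argument of the logarithm) vanishes at some $(x,y)$ with $T(y)V(x\,|\,y)>0$. Write $|t|^+=\max\{0,t\}$. **Theorem (random-coding error exponent).** $\overline P_e^{(n)}>0$ for all sufficiently large $n$, and $$\lim_{n\to\infty}-\frac1n\log\overline P_e^{(n)}=E_e(P,R,K),\qquad E_e(P,R,K)=\min_{T,V}\Big\{D(TV\,\|\,PW)+\big|A_{TV}-R+|B_{TV}-K|^+\big|^+\Big\},$$ where the minimum over all $T,V$ is attained and finite. -/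

import Mathlib

open Filter Topology

noncomputable section

namespace CloudChannel

/-- Number of messages `⌊e^{nR}⌋` (also used as the cloud size `⌊e^{nK}⌋`). -/
def expSize (n : ℕ) (r : ℝ) : ℕ := ⌊Real.exp (n * r)⌋₊

/-- A codebook: one codeword of length `n` for each of the `M` messages. -/
abbrev Codebook (X : Type*) (n M : ℕ) : Type _ := Fin M → Fin n → X

/-- A channel instance: for each of the `M` messages, a cloud of `L` (not necessarily distinct)
output vectors of length `n`. -/
abbrev Clouds (Y : Type*) (n M L : ℕ) : Type _ := Fin M → Fin L → Fin n → Y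

section Model

variable {X Y : Type*} [Fintype X] [Fintype Y] [DecidableEq Y]

/-- Probability of a codebook whose letters are drawn i.i.d. from `P`. -/
def codebookProb {n M : ℕ} (P : X → ℝ) (c : Codebook X n M) : ℝ :=
  ∏ m, ∏ i, P (c m i)

/-- Conditional probability of a channel instance given the codebook: all the vectors in all the
clouds are independent, and the `i`-th letter of a vector in the cloud of `m` is drawn from
`W (· | x_{m i})`, independently of the other letters. Here `W x y` stands for `W(y | x)`. -/
def cloudsProb {n M L : ℕ} (W : X → Y → ℝ) (c : Codebook X n M) (k : Clouds Y n M L) : ℝ :=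
  ∏ m, ∏ l, ∏ i, W (c m i) (k m l i)

/-- Number of replicas of the vector `y` in the cloud of the message `m`. -/
def replicas {n M L : ℕ} (k : Clouds Y n M L) (m : Fin M) (y : Fin n → Y) : ℕ :=
  (Finset.univ.filter fun l => k m l = y).card

/-- Transition probability of the channel instance: given the message `m`, the output is an
element of the cloud of `m` chosen uniformly among its `L` positions. -/
def channelProb {n M L : ℕ} (k : Clouds Y n M L) (m : Fin M) (y : Fin n → Y) : ℝ :=
  (replicas k m y : ℝ) / (L : ℝ)

/-- A (possibly randomized) decoder, which knows the codebook and the channel instance: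
`δ c k y m` is the probability that it outputs `m` when `y` is received. -/
abbrev Decoder (X Y : Type*) (n M L : ℕ) : Type _ :=
  Codebook X n M → Clouds Y n M L → (Fin n → Y) → Fin M → ℝ

/-- A maximum-likelihood decoder: its output is distributed on the messages that maximize the
likelihood of the received vector; ties are broken arbitrarily. -/
def IsMLDecoder {n M L : ℕ} (δ : Decoder X Y n M L) : Prop :=
  ∀ c k y, δ c k y ∈ stdSimplex ℝ (Fin M) ∧
    ∀ m, δ c k y m ≠ 0 → ∀ m', channelProb k m' y ≤ channelProb k m y

/-- Error probability for a given codebook and a given channel instance, averaged over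
equiprobable messages and over the channel action. -/
def instanceError {n M L : ℕ} (δ : Decoder X Y n M L) (c : Codebook X n M)
    (k : Clouds Y n M L) : ℝ :=
  (1 / (M : ℝ)) * ∑ m, ∑ y, channelProb k m y * (1 - δ c k y m)

/-- Error probability averaged over messages, codebooks and channel instances. -/
def avgError {n M L : ℕ} (P : X → ℝ) (W : X → Y → ℝ) (δ : Decoder X Y n M L) : ℝ :=
  ∑ c : Codebook X n M, codebookProb P c *
    ∑ k : Clouds Y n M L, cloudsProb W c k * instanceError δ c k

end Model

section Exponent

variable {X Y : Type*} [Fintype X] [Fintype Y]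

open Classical in
/-- `D(TV ‖ PW)`, with value `⊤` unless `TV ≪ PW`. Here `V y x` stands for `V(x | y)`. -/
def divJoint (P : X → ℝ) (W : X → Y → ℝ) (T : Y → ℝ) (V : Y → X → ℝ) : EReal :=
  if ∀ y x, P x * W x y = 0 → T y * V y x = 0 then
    ((∑ y, ∑ x, T y * V y x * Real.log (T y * V y x / (P x * W x y)) : ℝ) : EReal)
  else ⊤

open Classical in
/-- `A_{TV} = D(V ‖ P | T)`, with value `⊤` unless `V(· | y) ≪ P` for `T`-almost every `y`. -/
def divCond (P : X → ℝ) (T : Y → ℝ) (V : Y → X → ℝ) : EReal :=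
  if ∀ y x, P x = 0 → T y * V y x = 0 then
    ((∑ y, ∑ x, T y * V y x * Real.log (V y x / P x) : ℝ) : EReal)
  else ⊤

open Classical in
/-- `B_{TV} = E_{TV}[-log W(Y | X)]`, with `-log 0 = ⊤` and `0 * ⊤ = 0`. -/
def expNegLog (W : X → Y → ℝ) (T : Y → ℝ) (V : Y → X → ℝ) : EReal :=
  if ∀ y x, W x y = 0 → T y * V y x = 0 then
    ((∑ y, ∑ x, T y * V y x * (-Real.log (W x y)) : ℝ) : EReal)
  else ⊤

/-- `D(TV ‖ PW) + | A_{TV} - R + | B_{TV} - K |⁺ |⁺`. -/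
def objective (P : X → ℝ) (W : X → Y → ℝ) (R K : ℝ) (T : Y → ℝ) (V : Y → X → ℝ) : EReal :=
  divJoint P W T V +
    max 0 (divCond P T V - (R : EReal) + max 0 (expNegLog W T V - (K : EReal)))

/-- The values of the objective over all the joint distributions `T(y) V(x | y)`. -/
def objectiveValues (P : X → ℝ) (W : X → Y → ℝ) (R K : ℝ) : Set EReal :=
  {e | ∃ T ∈ stdSimplex ℝ Y, ∃ V : Y → X → ℝ, (∀ y, V y ∈ stdSimplex ℝ X) ∧
    e = objective P W R K T V}

/-- The exponent `E_e(P, R, K)`. -/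
def errorExponent (P : X → ℝ) (W : X → Y → ℝ) (R K : ℝ) : EReal :=
  sInf (objectiveValues P W R K)

end Exponent

end CloudChannel

end

set_option linter.unusedSectionVars false

/-! Fix an output word `y` and let N_m be its number of replicas in the cloud of m. Under any tie
rule, maximum likelihood leaves the loss ∑ N_m − max N_m (`sum_mul_one_sub_eq`). Hence the average
error is (ML)⁻¹ ∑_y E[∑ N_m − max N_m] (`avgError_eq`), where the pairs (codeword, cloud) are i.i.d.
over the M messages. A loss needs replicas in two different clouds, so it is compared with sums over
pairs of distinct messages, whose means factorize.

Let π be the probability that a codeword has a given joint type with `y`, and q the common value of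
W^n(y|x) on that type. About Mπ codewords have the type, and each cloud contains `y` with
probability about min(1, Lq), so a competitor exists with probability about min(1, Mπ min(1, Lq)).
The transmitted pair has type TV with probability about exp(−nD(TV‖PW)), while π ≈ exp(−nA) and q =
exp(−nB). The two nested minima become the two nested positive parts of the exponent.

Upper bound (`avgError_le`): the loss is at most a sum of √N_m √N_m' over pairs, and E√N is at most
min(√(Lq), Lq). Types already filled with competitors are charged their whole mean instead. There
are polynomially many types, so the worst one decides.

Lower bound (`avgError_ge`): for a minimizing TV only replicas on TV-typical pairs are kept. A
second-moment inequality bounds the loss from below (`le_sum_mul_one_sub`, `le_mean_errorCount`),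
and Chebyshev's inequality shows that typical pairs carry at least half of the TV-mass.

The minimum is attained because the distributions TV ≪ PW form a compact set on which the objective
is continuous (`exists_minimizer`). -/

namespace CloudChannel

noncomputable section

/-! ### Moments of i.i.d. families and deterministic bounds on the decoding loss. -/

section

/-- Weighted sum of `f`; the expectation of `f` when `w` is a probability distribution. -/
def mean {Ω : Type*} [Fintype Ω] (w f : Ω → ℝ) : ℝ := ∑ z, w z * f z

/-- Product weight on families indexed by `ι`. -/
def iid {ι Z : Type*} [Fintype ι] (w : Z → ℝ) (z : ι → Z) : ℝ := ∏ i, w (z i)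

section Mean

variable {Ω : Type*} [Fintype Ω] {w : Ω → ℝ}

lemma mean_add (f g : Ω → ℝ) : mean w (fun z => f z + g z) = mean w f + mean w g := by
  simp [mean, mul_add, Finset.sum_add_distrib]

lemma mean_sub (f g : Ω → ℝ) : mean w (fun z => f z - g z) = mean w f - mean w g := by
  simp [mean, mul_sub, Finset.sum_sub_distrib]

lemma mean_const_mul (c : ℝ) (f : Ω → ℝ) : mean w (fun z => c * f z) = c * mean w f := by
  simp only [mean, Finset.mul_sum]
  exact Finset.sum_congr rfl fun z _ => by ring

lemma mean_sum {α : Type*} (s : Finset α) (f : α → Ω → ℝ) :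
    mean w (fun z => ∑ a ∈ s, f a z) = ∑ a ∈ s, mean w (f a) := by
  simp only [mean, Finset.mul_sum]
  exact Finset.sum_comm

lemma mean_mono (hw : ∀ z, 0 ≤ w z) {f g : Ω → ℝ} (h : ∀ z, f z ≤ g z) :
    mean w f ≤ mean w g :=
  Finset.sum_le_sum fun z _ => mul_le_mul_of_nonneg_left (h z) (hw z)

lemma mean_nonneg (hw : ∀ z, 0 ≤ w z) {f : Ω → ℝ} (h : ∀ z, 0 ≤ f z) : 0 ≤ mean w f :=
  Finset.sum_nonneg fun z _ => mul_nonneg (hw z) (h z)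

/-- Cauchy–Schwarz with the weight split as √w · √w. -/
lemma mean_sqrt_le (hw : ∀ z, 0 ≤ w z) (hw1 : ∑ z, w z = 1) {f : Ω → ℝ} (hf : ∀ z, 0 ≤ f z) :
    mean w (fun z => √(f z)) ≤ √(mean w f) := by
  apply Real.le_sqrt_of_sq_le
  have h := Finset.sum_mul_sq_le_sq_mul_sq Finset.univ (fun z => √(w z)) (fun z => √(w z) * √(f z))
  have e1 : ∀ z, √(w z) * (√(w z) * √(f z)) = w z * √(f z) := fun z => by
    rw [← mul_assoc, Real.mul_self_sqrt (hw z)]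
  have e2 : ∀ z, (√(w z) * √(f z)) ^ 2 = w z * f z := fun z => by
    rw [mul_pow, Real.sq_sqrt (hw z), Real.sq_sqrt (hf z)]
  have e3 : ∀ z, √(w z) ^ 2 = w z := fun z => Real.sq_sqrt (hw z)
  simp only [e1, e2, e3, hw1, one_mul] at h
  exact h

end Mean

section Iid

variable {ι Z : Type*} [Fintype ι] [Fintype Z] {w : Z → ℝ}

lemma iid_nonneg (hw : ∀ z, 0 ≤ w z) (z : ι → Z) : 0 ≤ iid w z :=
  Finset.prod_nonneg fun i _ => hw (z i)

variable [DecidableEq ι]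

lemma sum_iid (hw : ∑ z, w z = 1) : ∑ z : ι → Z, iid w z = 1 := by
  have h := Finset.prod_univ_sum (fun _ : ι => (Finset.univ : Finset Z)) (fun _ z => w z)
  simp only [hw, Finset.prod_const_one, Fintype.piFinset_univ] at h
  exact h.symm

lemma mean_iid_prod (hw : ∑ z, w z = 1) (s : Finset ι) (f : ι → Z → ℝ) :
    mean (iid w) (fun z : ι → Z => ∏ i ∈ s, f i (z i)) = ∏ i ∈ s, mean w (f i) := by
  -- Padding with the factor 1 outside `s` makes the product run over all indices, so it expands
  -- into a sum over families.
  have h := Finset.prod_univ_sum (fun _ : ι => (Finset.univ : Finset Z))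
    (fun i z => w z * if i ∈ s then f i z else 1)
  rw [Fintype.piFinset_univ] at h
  have e1 : ∀ z : ι → Z, ∏ i, (w (z i) * if i ∈ s then f i (z i) else 1)
      = iid w z * ∏ i ∈ s, f i (z i) := fun z => by
    rw [Finset.prod_mul_distrib, Finset.prod_ite_mem, Finset.univ_inter]; rfl
  have e2 : ∀ i, (∑ z, w z * if i ∈ s then f i z else 1) = if i ∈ s then mean w (f i) else 1 :=
    fun i => by
      split_ifs
      · rfl
      · simpa using hw
  simp only [e1, e2, Finset.prod_ite_mem, Finset.univ_inter] at h
  exact h.symm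

lemma mean_iid_single (hw : ∑ z, w z = 1) (i : ι) (f : Z → ℝ) :
    mean (iid w) (fun z : ι → Z => f (z i)) = mean w f := by
  simpa using mean_iid_prod hw {i} (fun _ => f)

lemma mean_iid_pair (hw : ∑ z, w z = 1) {i j : ι} (hij : i ≠ j) (f g : Z → ℝ) :
    mean (iid w) (fun z : ι → Z => f (z i) * g (z j)) = mean w f * mean w g := by
  have h := mean_iid_prod hw {i, j} (fun k => if k = i then f else g)
  simpa [Finset.prod_pair hij, hij.symm] using h

lemma mean_iid_triple (hw : ∑ z, w z = 1) {i j l : ι} (hij : i ≠ j) (hil : i ≠ l) (hjl : j ≠ l)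
    (f : Z → ℝ) :
    mean (iid w) (fun z : ι → Z => f (z i) * f (z j) * f (z l)) = mean w f ^ 3 := by
  have h := mean_iid_prod hw {i, j, l} (fun _ => f)
  rw [Finset.prod_const, Finset.card_eq_three.2 ⟨i, j, l, hij, hil, hjl, rfl⟩] at h
  rw [← h]
  congr 1
  funext z
  rw [Finset.prod_insert (by simp [hij, hil]), Finset.prod_pair hjl, mul_assoc]

/-- Sum of the products over ordered pairs of distinct indices. -/
def pairSum (a : ι → ℝ) : ℝ := ∑ p ∈ (Finset.univ : Finset ι).offDiag, a p.1 * a p.2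

lemma pairSum_eq (a : ι → ℝ) : pairSum a = (∑ i, a i) ^ 2 - ∑ i, a i ^ 2 := by
  have h := Finset.sum_union (Finset.disjoint_diag_offDiag (Finset.univ : Finset ι))
    (f := fun p : ι × ι => a p.1 * a p.2)
  rw [Finset.diag_union_offDiag, Finset.sum_diag, Finset.sum_product] at h
  have e : (∑ i, a i) ^ 2 = ∑ i, ∑ j, a i * a j := by rw [sq, Finset.sum_mul_sum]
  rw [pairSum, e, h]
  simp [sq]

lemma pairSum_nonneg {a : ι → ℝ} (ha : ∀ i, 0 ≤ a i) : 0 ≤ pairSum a :=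
  Finset.sum_nonneg fun _ _ => mul_nonneg (ha _) (ha _)

lemma card_offDiag_univ : (((Finset.univ : Finset ι).offDiag.card : ℕ) : ℝ)
    = (Fintype.card ι : ℝ) * ((Fintype.card ι : ℝ) - 1) := by
  rw [Finset.offDiag_card, Nat.cast_sub (Nat.le_mul_self _), Finset.card_univ]
  push_cast; ring

lemma mean_pairSum (hw : ∑ z, w z = 1) (f : Z → ℝ) :
    mean (iid w) (fun z : ι → Z => pairSum fun i => f (z i))
      = (Fintype.card ι : ℝ) * ((Fintype.card ι : ℝ) - 1) * mean w f ^ 2 := by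
  simp only [pairSum]
  rw [mean_sum, Finset.sum_congr rfl (g := fun _ => mean w f ^ 2), Finset.sum_const,
    nsmul_eq_mul, card_offDiag_univ]
  intro p hp
  rw [mean_iid_pair hw (Finset.mem_offDiag.1 hp).2.2 f f, sq]

lemma mean_pairSum_mul_sum_le (hw : ∑ z, w z = 1) (hw0 : ∀ z, 0 ≤ w z) {f : Z → ℝ}
    (hf : ∀ z, 0 ≤ f z) :
    mean (iid w) (fun z : ι → Z => (pairSum fun i => f (z i)) * ∑ l, f (z l))
      ≤ (Fintype.card ι : ℝ) * ((Fintype.card ι : ℝ) - 1) *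
        (mean w f * (2 * mean w (fun z => f z ^ 2) + Fintype.card ι * mean w f ^ 2)) := by
  have hm : 0 ≤ mean w f := mean_nonneg hw0 hf
  have hm2 : 0 ≤ mean w (fun z => f z ^ 2) := mean_nonneg hw0 fun z => sq_nonneg _
  simp only [pairSum, Finset.sum_mul]
  rw [mean_sum, ← card_offDiag_univ, ← nsmul_eq_mul]
  apply Finset.sum_le_card_nsmul
  intro p hp
  have hp' := (Finset.mem_offDiag.1 hp).2.2
  simp only [Finset.mul_sum]
  rw [mean_sum]
  -- An index `l` that meets the pair turns one factor into a square; otherwise the three factors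
  -- are independent. Keeping the cube in every case only enlarges the bound.
  have key : ∀ l, mean (iid w) (fun z : ι → Z => f (z p.1) * f (z p.2) * f (z l))
      ≤ mean w f ^ 3 + (if l = p.1 then mean w f * mean w (fun z => f z ^ 2) else 0)
        + (if l = p.2 then mean w f * mean w (fun z => f z ^ 2) else 0) := by
    intro l
    have h3 : 0 ≤ mean w f ^ 3 := by positivity
    have h4 : 0 ≤ mean w f * mean w (fun z => f z ^ 2) := by positivity
    by_cases h1 : l = p.1
    · have : (fun z : ι → Z => f (z p.1) * f (z p.2) * f (z l))
          = fun z : ι → Z => f (z p.2) * (fun a => f a ^ 2) (z p.1) := by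
        funext z; rw [h1]; ring
      rw [this, mean_iid_pair hw (Ne.symm hp') f (fun a => f a ^ 2), if_pos h1, h1, if_neg hp']
      linarith
    by_cases h2 : l = p.2
    · have : (fun z : ι → Z => f (z p.1) * f (z p.2) * f (z l))
          = fun z : ι → Z => f (z p.1) * (fun a => f a ^ 2) (z p.2) := by
        funext z; rw [h2]; ring
      rw [this, mean_iid_pair hw hp' f (fun a => f a ^ 2), if_neg h1, if_pos h2]
      linarith
    · rw [mean_iid_triple hw hp' (Ne.symm h1) (Ne.symm h2), if_neg h1, if_neg h2]
      linarith
  refine (Finset.sum_le_sum fun l _ => key l).trans (le_of_eq ?_)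
  simp only [Finset.sum_add_distrib, Finset.sum_const, Finset.sum_ite_eq', Finset.mem_univ, if_true,
    nsmul_eq_mul, Finset.card_univ]
  ring

/-- Second moment of a sum of centred i.i.d. variables. -/
lemma mean_sum_sq (hw : ∑ z, w z = 1) {f : Z → ℝ} (hf : mean w f = 0) :
    mean (iid w) (fun z : ι → Z => (∑ i, f (z i)) ^ 2)
      = Fintype.card ι * mean w (fun z => f z ^ 2) := by
  have e : (fun z : ι → Z => (∑ i, f (z i)) ^ 2)
      = fun z => (pairSum fun i => f (z i)) + ∑ i, (fun a => f a ^ 2) (z i) := by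
    funext z; rw [pairSum_eq]; ring
  rw [e, mean_add, mean_pairSum hw, hf, mean_sum,
    Finset.sum_congr rfl fun i _ => mean_iid_single hw i fun a => f a ^ 2]
  simp

end Iid

section Pointwise

variable {ι : Type*} [Fintype ι] [DecidableEq ι] {N d : ι → ℝ}

/-- Since `d` lives on the maximizers of `N`, the tie rule has no effect on the loss. -/
lemma sum_mul_one_sub_eq (hd : d ∈ stdSimplex ℝ ι)
    (hmax : ∀ m, d m ≠ 0 → ∀ m', N m' ≤ N m) {j : ι} (hj : ∀ m, N m ≤ N j) :
    ∑ m, N m * (1 - d m) = ∑ m, N m - N j := by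
  have h : ∀ m, N m * d m = N j * d m := fun m => by
    by_cases h0 : d m = 0
    · simp [h0]
    · rw [le_antisymm (hj m) (hmax m h0 j)]
  simp only [mul_sub, mul_one, Finset.sum_sub_distrib, h]
  rw [← Finset.mul_sum, hd.2, mul_one]

/-- If `k` maximizes `v`, then v_m ≤ √v_m √v_k for m ≠ k, and these products are terms of the pair
sum. Square roots, unlike products v_m v_k, stay sharp when counts are large. The part `u` is
charged in full. -/
lemma sum_mul_one_sub_le (hd : d ∈ stdSimplex ℝ ι)
    (hmax : ∀ m, d m ≠ 0 → ∀ m', N m' ≤ N m)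
    (u v : ι → ℝ) (hu : ∀ m, 0 ≤ u m) (hv : ∀ m, 0 ≤ v m) (huv : ∀ m, N m = u m + v m) :
    ∑ m, N m * (1 - d m) ≤ ∑ m, u m + pairSum fun m => √(v m) := by
  have hne : Nonempty ι := by
    by_contra h
    rw [not_nonempty_iff] at h
    simpa using hd.2
  obtain ⟨j, hj⟩ := Finite.exists_max N
  obtain ⟨k, hk⟩ := Finite.exists_max v
  rw [sum_mul_one_sub_eq hd hmax hj]
  have h1 : ∑ m, v m - v k ≤ pairSum fun m => √(v m) := by
    have h2 : ∑ m, v m - v k = ∑ m ∈ Finset.univ.erase k, v m := by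
      rw [← Finset.add_sum_erase _ _ (Finset.mem_univ k)]; ring
    rw [h2, pairSum]
    have h3 : ∑ m ∈ Finset.univ.erase k, v m
        ≤ ∑ m ∈ Finset.univ.erase k, √(v m) * √(v k) := by
      refine Finset.sum_le_sum fun m _ => ?_
      calc v m = √(v m) * √(v m) := (Real.mul_self_sqrt (hv m)).symm
        _ ≤ _ := mul_le_mul_of_nonneg_left (Real.sqrt_le_sqrt (hk m)) (Real.sqrt_nonneg _)
    refine h3.trans ?_
    have h4 : ∑ m ∈ Finset.univ.erase k, √(v m) * √(v k)
        = ∑ p ∈ (Finset.univ.erase k).image fun m => (m, k),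
          √(v p.1) * √(v p.2) := by
      rw [Finset.sum_image fun a _ b _ h => (Prod.ext_iff.1 h).1]
    rw [h4]
    refine Finset.sum_le_sum_of_subset_of_nonneg ?_ fun _ _ _ => by positivity
    intro p hp
    simp only [Finset.mem_image, Finset.mem_erase] at hp
    obtain ⟨m, hm, rfl⟩ := hp
    simp [hm.1]
  have h5 : ∑ m, N m = ∑ m, u m + ∑ m, v m := by
    rw [← Finset.sum_add_distrib]; exact Finset.sum_congr rfl fun m _ => huv m
  have h6 : v k ≤ N j := by
    have := hj k; have := huv k; have := hu k; linarith
  linarith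

/-- With S = ∑ a and Q the pair sum, Q ≤ S² − a_j² ≤ 2S(S − a_j), so 2t(1 − tS)Q ≤ 4tS(1 − tS)(S −
a_j) ≤ S − a_j when tS ≤ 1; when tS > 1 the left side is nonpositive. The left side involves only
low moments, and `t` is left free for later optimization. -/
lemma le_sum_mul_one_sub (hd : d ∈ stdSimplex ℝ ι)
    (hmax : ∀ m, d m ≠ 0 → ∀ m', N m' ≤ N m)
    {a : ι → ℝ} (ha : ∀ m, 0 ≤ a m) (haN : ∀ m, a m ≤ N m) {t : ℝ} (ht : 0 ≤ t) :
    2 * t * pairSum a - 2 * t ^ 2 * (pairSum a * ∑ m, a m) ≤ ∑ m, N m * (1 - d m) := by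
  have hne : Nonempty ι := by
    by_contra h
    rw [not_nonempty_iff] at h
    simpa using hd.2
  obtain ⟨j, hj⟩ := Finite.exists_max N
  rw [sum_mul_one_sub_eq hd hmax hj]
  have h1 : ∑ m, a m - a j ≤ ∑ m, N m - N j := by
    rw [← Finset.add_sum_erase _ a (Finset.mem_univ j),
      ← Finset.add_sum_erase _ N (Finset.mem_univ j), add_sub_cancel_left, add_sub_cancel_left]
    exact Finset.sum_le_sum fun m _ => haN m
  refine le_trans ?_ h1
  have hQ := pairSum_nonneg ha
  have hjS : a j ≤ ∑ m, a m :=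
    Finset.single_le_sum (f := a) (fun m _ => ha m) (Finset.mem_univ j)
  have hj2 : a j ^ 2 ≤ ∑ m, a m ^ 2 :=
    Finset.single_le_sum (f := fun m => a m ^ 2) (fun m _ => sq_nonneg _) (Finset.mem_univ j)
  have hQle : pairSum a ≤ 2 * (∑ m, a m) * (∑ m, a m - a j) := by
    rw [pairSum_eq]; nlinarith [ha j]
  set S := ∑ m, a m
  by_cases h : t * S ≤ 1
  · have h2 : 0 ≤ 2 * t * (1 - t * S) := mul_nonneg (by linarith) (by linarith)
    calc 2 * t * pairSum a - 2 * t ^ 2 * (pairSum a * S)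
        = 2 * t * (1 - t * S) * pairSum a := by ring
      _ ≤ 2 * t * (1 - t * S) * (2 * S * (S - a j)) := mul_le_mul_of_nonneg_left hQle h2
      _ = (S - a j) - (S - a j) * (1 - 2 * (t * S)) ^ 2 := by ring
      _ ≤ S - a j := sub_le_self _ (mul_nonneg (by linarith) (sq_nonneg _))
  · have h2 : 0 ≤ 2 * t * (t * S - 1) := mul_nonneg (by linarith) (by linarith)
    have h3 := mul_nonneg h2 hQ
    nlinarith

end Pointwise

end

/-! ### Mean decoding loss for a fixed output word. -/

section

variable {X Y : Type*} [Fintype X] [Fintype Y]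

/-- Memoryless transition probability `W^n(y | x)`. -/
def wordProb {n : ℕ} (W : X → Y → ℝ) (x : Fin n → X) (y : Fin n → Y) : ℝ := ∏ i, W (x i) (y i)

lemma wordProb_nonneg {n : ℕ} {W : X → Y → ℝ} (hW : ∀ x, W x ∈ stdSimplex ℝ Y)
    (x : Fin n → X) (y : Fin n → Y) : 0 ≤ wordProb W x y :=
  Finset.prod_nonneg fun i _ => (hW (x i)).1 (y i)

lemma sum_wordProb {n : ℕ} {W : X → Y → ℝ} (hW : ∀ x, W x ∈ stdSimplex ℝ Y)
    (x : Fin n → X) : ∑ y, wordProb W x y = 1 := by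
  have h := Finset.prod_univ_sum (fun _ : Fin n => (Finset.univ : Finset Y))
    (fun i y => W (x i) y)
  simp only [(hW _).2, Finset.prod_const_one, Fintype.piFinset_univ] at h
  exact h.symm

/-- Number of occurrences of `y` in a cloud. -/
def count {L : ℕ} {Z : Type*} [DecidableEq Z] (k : Fin L → Z) (y : Z) : ℕ :=
  (Finset.univ.filter fun l => k l = y).card

lemma sqrt_le_self_of_one_le {s : ℝ} (hs : 1 ≤ s) : √s ≤ s :=
  Real.sqrt_le_iff.2 ⟨by linarith, by nlinarith⟩

section Count

variable {L : ℕ} {Z : Type*} [Fintype Z] [DecidableEq Z] {w : Z → ℝ}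

lemma count_eq_sum (k : Fin L → Z) (y : Z) :
    (count k y : ℝ) = ∑ l, if k l = y then (1 : ℝ) else 0 := by
  simp [count]

lemma mean_ite_eq (y : Z) : mean w (fun z => if z = y then (1 : ℝ) else 0) = w y := by
  simp [mean]

lemma mean_count (hw : ∑ z, w z = 1) (y : Z) :
    mean (iid w) (fun k : Fin L → Z => (count k y : ℝ)) = L * w y := by
  simp only [count_eq_sum]
  rw [mean_sum, Finset.sum_congr rfl fun l _ =>
    mean_iid_single hw l fun z => if z = y then (1 : ℝ) else 0]
  simp [mean_ite_eq]

/-- The square of a sum of indicators is its pair sum plus the sum itself. -/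
lemma mean_count_sq_le (hw : ∑ z, w z = 1) (hw0 : ∀ z, 0 ≤ w z) (y : Z) :
    mean (iid w) (fun k : Fin L → Z => (count k y : ℝ) ^ 2) ≤ L * w y + (L * w y) ^ 2 := by
  have e : (fun k : Fin L → Z => (count k y : ℝ) ^ 2)
      = fun k => (pairSum fun l => (fun z => if z = y then (1 : ℝ) else 0) (k l))
        + (count k y : ℝ) := by
    funext k
    rw [pairSum_eq, count_eq_sum]
    simp
  rw [e, mean_add, mean_pairSum hw fun z => if z = y then (1 : ℝ) else 0, mean_ite_eq, mean_count hw, Fintype.card_fin]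
  have : (0 : ℝ) ≤ L * w y ^ 2 := by have := hw0 y; positivity
  nlinarith

/-- The first bound is Jensen's, good for many expected replicas; the second uses that √k ≤ k for
integers, good for few. -/
lemma mean_sqrt_count_le (hw : ∑ z, w z = 1) (hw0 : ∀ z, 0 ≤ w z) (y : Z) :
    mean (iid w) (fun k : Fin L → Z => √(count k y : ℝ)) ≤ min (√(L * w y)) (L * w y) := by
  refine le_min ?_ ?_
  · rw [← mean_count hw y]
    exact mean_sqrt_le (iid_nonneg hw0) (sum_iid hw) fun k => Nat.cast_nonneg _
  · rw [← mean_count hw y]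
    refine mean_mono (iid_nonneg hw0) fun k => ?_
    rcases Nat.eq_zero_or_pos (count k y) with h | h
    · simp [h]
    · have h1 : (1 : ℝ) ≤ count k y := by exact_mod_cast h
      exact sqrt_le_self_of_one_le h1

end Count

/-- Joint weight of the codeword and the cloud of one message. -/
def msgWeight {n L : ℕ} (P : X → ℝ) (W : X → Y → ℝ)
    (z : (Fin n → X) × (Fin L → Fin n → Y)) : ℝ :=
  iid P z.1 * iid (wordProb W z.1) z.2

lemma mean_msgWeight {n L : ℕ} (P : X → ℝ) (W : X → Y → ℝ)
    (f : (Fin n → X) × (Fin L → Fin n → Y) → ℝ) :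
    mean (msgWeight P W) f
      = ∑ x, iid P x * mean (iid (wordProb W x)) (fun k => f (x, k)) := by
  simp only [mean, msgWeight, Fintype.sum_prod_type, Finset.mul_sum, mul_assoc]

section Channel

variable {n M L : ℕ} {P : X → ℝ} {W : X → Y → ℝ}

lemma msgWeight_nonneg (hP : P ∈ stdSimplex ℝ X) (hW : ∀ x, W x ∈ stdSimplex ℝ Y)
    (z : (Fin n → X) × (Fin L → Fin n → Y)) : 0 ≤ msgWeight P W z :=
  mul_nonneg (iid_nonneg hP.1 _) (iid_nonneg (wordProb_nonneg hW _) _)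

lemma sum_msgWeight (hP : P ∈ stdSimplex ℝ X) (hW : ∀ x, W x ∈ stdSimplex ℝ Y) :
    ∑ z, msgWeight (n := n) (L := L) P W z = 1 := by
  simp only [msgWeight, Fintype.sum_prod_type, ← Finset.mul_sum]
  simp only [sum_iid (sum_wordProb hW _), mul_one, sum_iid hP.2]

variable [DecidableEq Y]

/-- `1 - δ` weighted number of replicas of `y`, as a function of the codewords and clouds. -/
def errorCount (δ : Decoder X Y n M L) (y : Fin n → Y)
    (z : Fin M → (Fin n → X) × (Fin L → Fin n → Y)) : ℝ :=
  ∑ m, (count (z m).2 y : ℝ) * (1 - δ (fun m => (z m).1) (fun m => (z m).2) y m)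

/-- Regrouping codebook and clouds by message gives M i.i.d. pairs, which makes the moment lemmas
applicable for each `y` separately. -/
lemma avgError_eq (δ : Decoder X Y n M L) :
    avgError P W δ
      = 1 / (M * L) * ∑ y, mean (iid (msgWeight P W)) (errorCount δ y) := by
  have h1 : ∀ (c : Codebook X n M) (k : Clouds Y n M L), instanceError δ c k
      = 1 / (M * L) * ∑ y, errorCount δ y (fun m => (c m, k m)) := by
    intro c k
    simp only [instanceError, errorCount, channelProb]
    rw [Finset.sum_comm, one_div_mul_eq_div, one_div_mul_eq_div, ← div_div, div_right_comm,
      Finset.sum_div _ _ (L : ℝ)]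
    congr 1
    refine Finset.sum_congr rfl fun y _ => ?_
    rw [Finset.sum_div]
    exact Finset.sum_congr rfl fun m _ => by rw [div_mul_eq_mul_div]; rfl
  have h2 : ∀ f : (Fin M → (Fin n → X) × (Fin L → Fin n → Y)) → ℝ,
      mean (iid (msgWeight P W)) f = ∑ c : Codebook X n M, codebookProb P c *
        ∑ k : Clouds Y n M L, cloudsProb W c k * f (fun m => (c m, k m)) := by
    intro f
    rw [mean, ← (Equiv.arrowProdEquivProdArrow (Fin M) (fun _ => Fin n → X)
      (fun _ => Fin L → Fin n → Y)).symm.sum_comp, Fintype.sum_prod_type]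
    refine Finset.sum_congr rfl fun c _ => ?_
    rw [Finset.mul_sum]
    refine Finset.sum_congr rfl fun k _ => ?_
    rw [← mul_assoc]
    congr 1
    simp only [iid, msgWeight, codebookProb, cloudsProb, wordProb, ← Finset.prod_mul_distrib]
    rfl
  simp only [avgError, h1, ← mean_sum]
  rw [h2]
  simp only [Finset.mul_sum]
  refine Finset.sum_congr rfl fun c _ => Finset.sum_congr rfl fun k _ =>
    Finset.sum_congr rfl fun y _ => by ring

lemma count_le_of_isMLDecoder {δ : Decoder X Y n M L} (hδ : IsMLDecoder δ) (hL : 0 < L)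
    (c : Codebook X n M) (k : Clouds Y n M L) (y : Fin n → Y) (m : Fin M)
    (hm : δ c k y m ≠ 0) (m' : Fin M) : (count (k m') y : ℝ) ≤ count (k m) y := by
  have h := (hδ c k y).2 m hm m'
  exact (div_le_div_iff_of_pos_right (by exact_mod_cast hL)).1 h

/-- The 0–1 function `g` selects the codewords treated by the pair bound; the remaining ones
contribute their full mean. -/
lemma mean_errorCount_le (hP : P ∈ stdSimplex ℝ X) (hW : ∀ x, W x ∈ stdSimplex ℝ Y)
    {δ : Decoder X Y n M L} (hδ : IsMLDecoder δ) (hL : 0 < L) (y : Fin n → Y)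
    (g : (Fin n → X) → ℝ) (hg : ∀ x, g x = 0 ∨ g x = 1) :
    mean (iid (msgWeight P W)) (errorCount δ y)
      ≤ M * (L * ∑ x, iid P x * ((1 - g x) * wordProb W x y))
        + M ^ 2 * (∑ x, iid P x *
          (g x * min (√(L * wordProb W x y)) (L * wordProb W x y))) ^ 2 := by
  have hs := sum_msgWeight (n := n) (L := L) hP hW
  have h0 := msgWeight_nonneg (n := n) (L := L) hP hW
  have hg0 : ∀ x, 0 ≤ g x := fun x => by rcases hg x with h | h <;> simp [h]
  have hg1 : ∀ x, 0 ≤ 1 - g x := fun x => by rcases hg x with h | h <;> simp [h]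
  set u : (Fin n → X) × (Fin L → Fin n → Y) → ℝ := fun z => (1 - g z.1) * count z.2 y with hu
  set v : (Fin n → X) × (Fin L → Fin n → Y) → ℝ := fun z => g z.1 * √(count z.2 y) with hv
  have hpt : ∀ z, errorCount δ y z
      ≤ ∑ m : Fin M, u (z m) + pairSum fun m : Fin M => v (z m) := by
    intro z
    have h := sum_mul_one_sub_le (hδ (fun m => (z m).1) (fun m => (z m).2) y).1
      (N := fun m => (count (z m).2 y : ℝ))
      (count_le_of_isMLDecoder hδ hL (fun m => (z m).1) (fun m => (z m).2) y)
      (fun m => u (z m)) (fun m => g (z m).1 * count (z m).2 y)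
      (fun m => mul_nonneg (hg1 _) (Nat.cast_nonneg _))
      (fun m => mul_nonneg (hg0 _) (Nat.cast_nonneg _)) (fun m => by simp only [hu]; ring)
    have e : ∀ m, √(g (z m).1 * count (z m).2 y) = v (z m) := fun m => by
      simp only [hv]
      rcases hg (z m).1 with h | h <;> simp [h]
    simp only [e] at h
    exact h
  have hmu : mean (msgWeight P W) u = L * ∑ x, iid P x * ((1 - g x) * wordProb W x y) := by
    rw [mean_msgWeight, Finset.mul_sum]
    refine Finset.sum_congr rfl fun x _ => ?_
    simp only [hu]
    rw [mean_const_mul, mean_count (sum_wordProb hW x)]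
    ring
  have hmv0 : 0 ≤ mean (msgWeight P W) v :=
    mean_nonneg h0 fun z => mul_nonneg (hg0 _) (Real.sqrt_nonneg _)
  have hmv : mean (msgWeight P W) v
      ≤ ∑ x, iid P x * (g x * min (√(L * wordProb W x y)) (L * wordProb W x y)) := by
    rw [mean_msgWeight]
    refine Finset.sum_le_sum fun x _ => mul_le_mul_of_nonneg_left ?_ (iid_nonneg hP.1 x)
    simp only [hv]
    rw [mean_const_mul]
    exact mul_le_mul_of_nonneg_left
      (mean_sqrt_count_le (sum_wordProb hW x) (wordProb_nonneg hW x) y) (hg0 x)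
  refine (mean_mono (iid_nonneg h0) hpt).trans ?_
  rw [mean_add, mean_sum, Finset.sum_congr rfl fun m _ => mean_iid_single hs m u,
    mean_pairSum hs v, hmu]
  simp only [Finset.sum_const, Finset.card_univ, Fintype.card_fin, nsmul_eq_mul]
  have hsq := pow_le_pow_left₀ hmv0 hmv 2
  have hM : (0 : ℝ) ≤ M := Nat.cast_nonneg _
  refine add_le_add_right ?_ _
  calc (M : ℝ) * (M - 1) * mean (msgWeight P W) v ^ 2
      ≤ M ^ 2 * mean (msgWeight P W) v ^ 2 := by
        refine mul_le_mul_of_nonneg_right ?_ (sq_nonneg _)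
        nlinarith
    _ ≤ _ := mul_le_mul_of_nonneg_left hsq (sq_nonneg _)

/-- Mean of `le_sum_mul_one_sub` for the counts thinned by `g`. The cap `b` on W^n(y|x) where `g` is
active controls the second moment, hence the term 2Lb in the denominator. -/
lemma le_mean_errorCount (hP : P ∈ stdSimplex ℝ X) (hW : ∀ x, W x ∈ stdSimplex ℝ Y)
    {δ : Decoder X Y n M L} (hδ : IsMLDecoder δ) (hL : 0 < L) (hM : 0 < M) (y : Fin n → Y)
    (g : (Fin n → X) → ℝ) (hg0 : ∀ x, 0 ≤ g x) (hg1 : ∀ x, g x ≤ 1)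
    {b : ℝ} (hb : 0 ≤ b) (hgb : ∀ x, g x * wordProb W x y ≤ b) {ν : ℝ}
    (hν : ν = ∑ x, iid P x * (g x * wordProb W x y)) :
    M * (M - 1) * (L * ν) ^ 2 / (2 * (2 + 2 * L * b + M * L * ν))
      ≤ mean (iid (msgWeight P W)) (errorCount δ y) := by
  have hs := sum_msgWeight (n := n) (L := L) hP hW
  have h0 := msgWeight_nonneg (n := n) (L := L) hP hW
  set a : (Fin n → X) × (Fin L → Fin n → Y) → ℝ := fun z => g z.1 * count z.2 y with ha
  have ha0 : ∀ z, 0 ≤ a z := fun z => mul_nonneg (hg0 _) (Nat.cast_nonneg _)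
  have hm : mean (msgWeight P W) a = L * ν := by
    rw [mean_msgWeight, hν, Finset.mul_sum]
    refine Finset.sum_congr rfl fun x _ => ?_
    simp only [ha]
    rw [mean_const_mul, mean_count (sum_wordProb hW x)]
    ring
  have hm2 : mean (msgWeight P W) (fun z => a z ^ 2) ≤ L * ν * (1 + L * b) := by
    rw [mean_msgWeight, hν, Finset.mul_sum, Finset.sum_mul]
    refine Finset.sum_le_sum fun x _ => ?_
    simp only [ha, mul_pow]
    rw [mean_const_mul]
    have hq := wordProb_nonneg hW x y
    have hp := iid_nonneg hP.1 x
    have hLq : 0 ≤ (L : ℝ) * wordProb W x y := mul_nonneg (Nat.cast_nonneg _) hq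
    have hgx := hg0 x
    have key : g x ^ 2 * (L * wordProb W x y + (L * wordProb W x y) ^ 2)
        ≤ L * (g x * wordProb W x y) * (1 + L * b) := by
      have e1 : g x ^ 2 ≤ g x := by nlinarith [hg1 x]
      calc g x ^ 2 * (L * wordProb W x y + (L * wordProb W x y) ^ 2)
          = g x ^ 2 * (L * wordProb W x y)
            + g x * (L * wordProb W x y) * (L * (g x * wordProb W x y)) := by ring
        _ ≤ g x * (L * wordProb W x y) + g x * (L * wordProb W x y) * (L * b) := by
            refine add_le_add (mul_le_mul_of_nonneg_right e1 hLq) ?_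
            exact mul_le_mul_of_nonneg_left
              (mul_le_mul_of_nonneg_left (hgb x) (Nat.cast_nonneg _)) (mul_nonneg hgx hLq)
        _ = _ := by ring
    calc iid P x * (g x ^ 2 * mean (iid (wordProb W x)) fun k : Fin L → Fin n → Y =>
            (count k y : ℝ) ^ 2)
        ≤ iid P x * (g x ^ 2 * (L * wordProb W x y + (L * wordProb W x y) ^ 2)) :=
          mul_le_mul_of_nonneg_left (mul_le_mul_of_nonneg_left
            (mean_count_sq_le (sum_wordProb hW x) (wordProb_nonneg hW x) y) (sq_nonneg _)) hp
      _ ≤ iid P x * (L * (g x * wordProb W x y) * (1 + L * b)) :=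
          mul_le_mul_of_nonneg_left key hp
      _ = _ := by ring
  have hν0 : 0 ≤ ν := by
    rw [hν]
    exact Finset.sum_nonneg fun x _ =>
      mul_nonneg (iid_nonneg hP.1 x) (mul_nonneg (hg0 x) (wordProb_nonneg hW x y))
  set D : ℝ := 2 + 2 * L * b + M * L * ν with hD
  have hDpos : 0 < D := by positivity
  -- This `t` maximizes 2t − 2t²D, with value 1/(2D).
  set t : ℝ := 1 / (2 * D) with ht
  have ht0 : 0 ≤ t := by positivity
  have hpt : ∀ z, 2 * t * (pairSum fun m : Fin M => a (z m))
      - 2 * t ^ 2 * ((pairSum fun m : Fin M => a (z m)) * ∑ m, a (z m)) ≤ errorCount δ y z := by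
    intro z
    refine le_sum_mul_one_sub (hδ (fun m => (z m).1) (fun m => (z m).2) y).1
      (N := fun m => (count (z m).2 y : ℝ))
      (count_le_of_isMLDecoder hδ hL (fun m => (z m).1) (fun m => (z m).2) y)
      (fun m => ha0 _) (fun m => ?_) ht0
    exact mul_le_of_le_one_left (Nat.cast_nonneg _) (hg1 _)
  refine le_trans ?_ (mean_mono (iid_nonneg h0) hpt)
  rw [mean_sub, mean_const_mul, mean_const_mul, mean_pairSum hs a, hm]
  have h3 := mean_pairSum_mul_sum_le (ι := Fin M) hs h0 ha0
  rw [hm] at h3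
  simp only [Fintype.card_fin] at h3 ⊢
  have hM1 : (0 : ℝ) ≤ M * (M - 1) := by
    have : (1 : ℝ) ≤ M := by exact_mod_cast hM
    exact mul_nonneg (by linarith) (by linarith)
  have hLν : 0 ≤ L * ν := mul_nonneg (Nat.cast_nonneg _) hν0
  have h4 : 2 * mean (msgWeight P W) (fun z => a z ^ 2) + M * (L * ν) ^ 2 ≤ L * ν * D := by
    calc _ ≤ 2 * (L * ν * (1 + L * b)) + M * (L * ν) ^ 2 := by linarith
      _ = L * ν * D := by rw [hD]; ring
  have h5 := h3.trans (mul_le_mul_of_nonneg_left (mul_le_mul_of_nonneg_left h4 hLν) hM1)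
  have h6 := mul_le_mul_of_nonneg_left h5 (show 0 ≤ 2 * t ^ 2 by positivity)
  have h7 : (M : ℝ) * (M - 1) * (L * ν) ^ 2 / (2 * D)
      = 2 * t * (M * (M - 1) * (L * ν) ^ 2)
        - 2 * t ^ 2 * (M * (M - 1) * (L * ν * (L * ν * D))) := by
    rw [ht]; field_simp; ring
  rw [h7]
  linarith

end Channel

section Classes

variable {S C : Type*} [Fintype S] [Fintype C] [DecidableEq C]

/-- Splitting a mixture into the classes of a finite partition. -/
lemma sum_classes (κ : S → C) (p : S → ℝ) (f : C → ℝ) :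
    ∑ x, p x * f (κ x) = ∑ c, (∑ x with κ x = c, p x) * f c := by
  rw [← Finset.sum_fiberwise (s := Finset.univ) (g := κ)]
  refine Finset.sum_congr rfl fun c _ => ?_
  rw [Finset.sum_mul]
  refine Finset.sum_congr rfl fun x hx => ?_
  rw [(Finset.mem_filter.1 hx).2]

lemma min_sqrt_self_sq {s : ℝ} (hs : 0 ≤ s) : min (√s) s ^ 2 = s * min 1 s := by
  rcases le_total s 1 with h | h
  · have : s ≤ √s := Real.le_sqrt_of_sq_le (by nlinarith)
    rw [min_eq_right this, min_eq_right h, sq]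
  · rw [min_eq_left (sqrt_le_self_of_one_le h), min_eq_left h, Real.sq_sqrt hs, mul_one]

/-- Cauchy–Schwarz over the classes removes cross terms at the cost of the factor |C|. On one class,
min(√s, s)² = s · min(1, s) with s = Lq turns the squared pair term into Mπ · s · (Mπ min(1, s)). -/
lemma mean_errorCount_le_classes [DecidableEq Y] {n M L : ℕ} {P : X → ℝ} {W : X → Y → ℝ}
    (hP : P ∈ stdSimplex ℝ X) (hW : ∀ x, W x ∈ stdSimplex ℝ Y)
    {δ : Decoder X Y n M L} (hδ : IsMLDecoder δ) (hL : 0 < L) (y : Fin n → Y)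
    (κ : (Fin n → X) → C) (q : C → ℝ) (hq0 : ∀ c, 0 ≤ q c)
    (hq : ∀ x, wordProb W x y = q (κ x)) (π : C → ℝ)
    (hπ : ∀ c, π c = ∑ x with κ x = c, iid P x) :
    mean (iid (msgWeight P W)) (errorCount δ y)
      ≤ Fintype.card C *
        ∑ c, M * π c * (L * q c) * min 1 (M * π c * min 1 (L * q c)) := by
  have hM : (0 : ℝ) ≤ M := Nat.cast_nonneg _
  have hLq : ∀ c, 0 ≤ L * q c := fun c => mul_nonneg (Nat.cast_nonneg _) (hq0 c)
  have hπ0 : ∀ c, 0 ≤ π c := fun c => by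
    rw [hπ]; exact Finset.sum_nonneg fun x _ => iid_nonneg hP.1 x
  -- The value 1 marks classes with fewer than one expected competitor, where the pair bound beats
  -- the full mean.
  set sat : C → ℝ := fun c => if M * π c * min 1 (L * q c) < 1 then 1 else 0 with hsat
  have h := mean_errorCount_le hP hW hδ hL y (fun x => sat (κ x))
    (fun x => by simp only [hsat]; split_ifs <;> simp)
  simp only [hq] at h
  rw [sum_classes κ (iid P) (fun c => (1 - sat c) * q c),
    sum_classes κ (iid P) (fun c => sat c * min (√(L * q c)) (L * q c))] at h
  simp only [← hπ] at h
  refine h.trans ?_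
  have hCS : (∑ c, π c * (sat c * min (√(L * q c)) (L * q c))) ^ 2
      ≤ Fintype.card C * ∑ c, (π c * (sat c * min (√(L * q c)) (L * q c))) ^ 2 := by
    have := sq_sum_le_card_mul_sum_sq (s := (Finset.univ : Finset C))
      (f := fun c => π c * (sat c * min (√(L * q c)) (L * q c)))
    simpa using this
  by_cases hC : IsEmpty C
  · simp
  rw [not_isEmpty_iff] at hC
  have hC1 : (1 : ℝ) ≤ Fintype.card C := by exact_mod_cast Fintype.card_pos
  have hfst : 0 ≤ M * (L * ∑ c, π c * ((1 - sat c) * q c)) := by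
    refine mul_nonneg hM (mul_nonneg (Nat.cast_nonneg _) (Finset.sum_nonneg fun c _ => ?_))
    refine mul_nonneg (hπ0 c) (mul_nonneg ?_ (hq0 c))
    simp only [hsat]; split_ifs <;> simp
  calc _ ≤ Fintype.card C * (M * (L * ∑ c, π c * ((1 - sat c) * q c)))
        + M ^ 2 * (Fintype.card C * ∑ c, (π c * (sat c * min (√(L * q c)) (L * q c))) ^ 2) :=
      add_le_add (le_mul_of_one_le_left hfst hC1) (mul_le_mul_of_nonneg_left hCS (sq_nonneg _))
    _ = Fintype.card C * ∑ c, (M * (L * (π c * ((1 - sat c) * q c)))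
        + M ^ 2 * (π c * (sat c * min (√(L * q c)) (L * q c))) ^ 2) := by
      rw [Finset.sum_add_distrib, ← Finset.mul_sum, ← Finset.mul_sum, ← Finset.mul_sum]; ring
    _ ≤ _ := by
      refine mul_le_mul_of_nonneg_left (Finset.sum_le_sum fun c _ => le_of_eq ?_) (by linarith)
      by_cases hc : M * π c * min 1 (L * q c) < 1
      · simp only [hsat, if_pos hc]
        rw [min_eq_right hc.le, mul_pow, mul_pow, min_sqrt_self_sq (hLq c)]
        ring
      · simp only [hsat, if_neg hc]
        rw [min_eq_left (not_lt.1 hc)]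
        ring

end Classes

end

/-! ### Method of types and the upper bound on the error. -/

section

variable {X Y : Type*} [Fintype X] [Fintype Y]

/-- Expectation of `f` under the joint distribution `T(y) V(x | y)`. -/
def jointMean (T : Y → ℝ) (V : Y → X → ℝ) (f : X → Y → ℝ) : ℝ := ∑ y, ∑ x, T y * V y x * f x y

/-- Log-likelihood ratio whose mean is `D(TV ‖ PW)`. -/
def llrJoint (P : X → ℝ) (W : X → Y → ℝ) (T : Y → ℝ) (V : Y → X → ℝ) (x : X) (y : Y) : ℝ :=
  Real.log (T y * V y x / (P x * W x y))

/-- Log-likelihood ratio whose mean is `D(V ‖ P | T)`. -/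
def llrCond (P : X → ℝ) (V : Y → X → ℝ) (x : X) (y : Y) : ℝ := Real.log (V y x / P x)

/-- The value of the objective when `TV ≪ PW`. -/
def realObjective (P : X → ℝ) (W : X → Y → ℝ) (R K : ℝ) (T : Y → ℝ) (V : Y → X → ℝ) : ℝ :=
  jointMean T V (llrJoint P W T V) +
    max 0 (jointMean T V (llrCond P V) - R + max 0 (jointMean T V (fun x y => -Real.log (W x y)) - K))

lemma objective_eq_coe {P : X → ℝ} {W : X → Y → ℝ} {T : Y → ℝ} {V : Y → X → ℝ} (R K : ℝ)
    (h : ∀ y x, P x * W x y = 0 → T y * V y x = 0) :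
    objective P W R K T V = (realObjective P W R K T V : EReal) := by
  have h1 : ∀ y x, P x = 0 → T y * V y x = 0 := fun y x hx => h y x (by simp [hx])
  have h2 : ∀ y x, W x y = 0 → T y * V y x = 0 := fun y x hx => h y x (by simp [hx])
  rw [objective, divJoint, divCond, expNegLog, if_pos h, if_pos h1, if_pos h2]
  have hmax : ∀ a b : ℝ, ((max a b : ℝ) : EReal) = max (a : EReal) b :=
    fun a b => EReal.coe_strictMono.monotone.map_max
  simp only [realObjective, jointMean, llrJoint, llrCond, EReal.coe_add, hmax,
    EReal.coe_sub, EReal.coe_zero]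

lemma objective_eq_top {P : X → ℝ} {W : X → Y → ℝ} {T : Y → ℝ} {V : Y → X → ℝ} (R K : ℝ)
    (h : ¬ ∀ y x, P x * W x y = 0 → T y * V y x = 0) : objective P W R K T V = ⊤ := by
  rw [objective, divJoint, if_neg h]
  exact EReal.top_add_of_ne_bot (ne_bot_of_le_ne_bot EReal.zero_ne_bot (le_max_left _ _))

/-- Change of measure: on a fixed type, the sum in the exponent is constant. -/
lemma prod_eq_prod_mul_exp {ι : Type*} (s : Finset ι) {u v : ι → ℝ}
    (hu : ∀ i ∈ s, 0 < u i) (hv : ∀ i ∈ s, 0 < v i) :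
    ∏ i ∈ s, u i = (∏ i ∈ s, v i) * Real.exp (-∑ i ∈ s, Real.log (v i / u i)) := by
  rw [← Finset.sum_neg_distrib, Real.exp_sum, ← Finset.prod_mul_distrib]
  refine Finset.prod_congr rfl fun i hi => ?_
  rw [Real.exp_neg, Real.exp_log (div_pos (hv i hi) (hu i hi)), inv_div,
    mul_div_cancel₀ _ (hv i hi).ne']

lemma exp_neg_mul_max_zero {n : ℝ} (hn : 0 ≤ n) (t : ℝ) :
    Real.exp (-(n * max 0 t)) = min 1 (Real.exp (-(n * t))) := by
  rcases le_total 0 t with h | h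
  · rw [max_eq_right h, min_eq_right]
    exact Real.exp_le_one_iff.2 (by nlinarith)
  · rw [max_eq_left h, min_eq_left]
    · simp
    · exact Real.one_le_exp_iff.2 (by nlinarith)

section Types

variable [DecidableEq X] [DecidableEq Y] {n : ℕ}

/-- Joint type of a pair of words. -/
def jointType (x : Fin n → X) (y : Fin n → Y) (a : X) (b : Y) : Fin (n + 1) :=
  ⟨(Finset.univ.filter fun i => x i = a ∧ y i = b).card,
    Nat.lt_succ_of_le ((Finset.card_filter_le _ _).trans (by simp))⟩

lemma jointType_val (x : Fin n → X) (y : Fin n → Y) (a : X) (b : Y) :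
    (jointType x y a b : ℕ) = (Finset.univ.filter fun i => x i = a ∧ y i = b).card := rfl

lemma sum_eq_sum_jointType (x : Fin n → X) (y : Fin n → Y) (f : X → Y → ℝ) :
    ∑ i, f (x i) (y i) = ∑ b, ∑ a, ((jointType x y a b : ℕ) : ℝ) * f a b := by
  rw [← Finset.sum_fiberwise (s := Finset.univ) (g := y)]
  refine Finset.sum_congr rfl fun b _ => ?_
  rw [← Finset.sum_fiberwise (g := x)]
  refine Finset.sum_congr rfl fun a _ => ?_
  rw [Finset.filter_filter, Finset.sum_congr rfl (g := fun _ => f a b), Finset.sum_const,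
    nsmul_eq_mul]
  · simp only [jointType_val, and_comm]
  · intro i hi
    obtain ⟨-, h1, h2⟩ := Finset.mem_filter.1 hi
    rw [h1, h2]

lemma prod_eq_prod_jointType (x : Fin n → X) (y : Fin n → Y) (f : X → Y → ℝ) :
    ∏ i, f (x i) (y i) = ∏ b, ∏ a, f a b ^ (jointType x y a b : ℕ) := by
  rw [← Finset.prod_fiberwise (s := Finset.univ) (g := y)]
  refine Finset.prod_congr rfl fun b _ => ?_
  rw [← Finset.prod_fiberwise (g := x)]
  refine Finset.prod_congr rfl fun a _ => ?_
  rw [Finset.filter_filter, Finset.prod_congr rfl (g := fun _ => f a b), Finset.prod_const]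
  · simp only [jointType_val, and_comm]
  · intro i hi
    obtain ⟨-, h1, h2⟩ := Finset.mem_filter.1 hi
    rw [h1, h2]

lemma jointType_pos (x : Fin n → X) (y : Fin n → Y) (i : Fin n) :
    0 < (jointType x y (x i) (y i) : ℕ) := by
  rw [jointType_val]
  exact Finset.card_pos.2 ⟨i, by simp⟩

lemma exists_of_jointType_pos {x : Fin n → X} {y : Fin n → Y} {a : X} {b : Y}
    (h : 0 < (jointType x y a b : ℕ)) : ∃ i, x i = a ∧ y i = b := by
  rw [jointType_val] at h
  obtain ⟨i, hi⟩ := Finset.card_pos.1 h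
  exact ⟨i, (Finset.mem_filter.1 hi).2⟩

/-- Empirical distribution of the outputs. -/
def typeOut (c : X → Y → Fin (n + 1)) (b : Y) : ℝ := ∑ a, ((c a b : ℕ) : ℝ) / n

/-- Empirical conditional distribution of the inputs, set to `P` where it is undefined. -/
def typeCond (P : X → ℝ) (c : X → Y → Fin (n + 1)) (b : Y) (a : X) : ℝ :=
  if typeOut c b = 0 then P a else ((c a b : ℕ) : ℝ) / n / typeOut c b

lemma typeOut_mul_typeCond (P : X → ℝ) (c : X → Y → Fin (n + 1)) (a : X) (b : Y) :
    typeOut c b * typeCond P c b a = ((c a b : ℕ) : ℝ) / n := by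
  rw [typeCond]
  split_ifs with h
  · rw [h, zero_mul]
    have h0 : ∀ a ∈ Finset.univ, (0 : ℝ) ≤ ((c a b : ℕ) : ℝ) / n := fun a _ => by positivity
    exact ((Finset.sum_eq_zero_iff_of_nonneg h0).1 h a (Finset.mem_univ a)).symm
  · rw [mul_div_cancel₀ _ h]

lemma typeOut_mem (hn : 0 < n) (x : Fin n → X) (y : Fin n → Y) :
    typeOut (jointType x y) ∈ stdSimplex ℝ Y := by
  refine ⟨fun b => Finset.sum_nonneg fun a _ => by positivity, ?_⟩
  have h := sum_eq_sum_jointType x y (fun _ _ => (1 : ℝ))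
  simp only [mul_one, Finset.sum_const, Finset.card_univ, Fintype.card_fin, nsmul_eq_mul] at h
  simp only [typeOut, ← Finset.sum_div]
  rw [← h, div_self]
  exact_mod_cast hn.ne'

lemma typeCond_mem {P : X → ℝ} (hP : P ∈ stdSimplex ℝ X) (c : X → Y → Fin (n + 1)) (b : Y) :
    typeCond P c b ∈ stdSimplex ℝ X := by
  by_cases h : typeOut c b = 0
  · have : typeCond P c b = P := by funext a; rw [typeCond, if_pos h]
    rwa [this]
  · have h0 : 0 ≤ typeOut c b := Finset.sum_nonneg fun a _ => by positivity
    refine ⟨fun a => ?_, ?_⟩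
    · rw [typeCond, if_neg h]; positivity
    · simp only [typeCond, if_neg h, ← Finset.sum_div _ _ (typeOut c b)]
      exact div_self h

lemma sum_eq_mul_jointMean (hn : 0 < n) (P : X → ℝ) {c : X → Y → Fin (n + 1)} {x : Fin n → X}
    {y : Fin n → Y} (hc : jointType x y = c) (f : X → Y → ℝ) :
    ∑ i, f (x i) (y i) = n * jointMean (typeOut c) (typeCond P c) f := by
  have hn' : (n : ℝ) ≠ 0 := by exact_mod_cast hn.ne'
  rw [sum_eq_sum_jointType, hc, jointMean, Finset.mul_sum]
  refine Finset.sum_congr rfl fun b _ => ?_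
  rw [Finset.mul_sum]
  refine Finset.sum_congr rfl fun a _ => ?_
  rw [typeOut_mul_typeCond]
  field_simp

/-- Probability that an i.i.d. codeword has the joint type `c` with `y`. -/
def typeProb (P : X → ℝ) (y : Fin n → Y) (c : X → Y → Fin (n + 1)) : ℝ :=
  ∑ x with jointType x y = c, iid P x

/-- Common value of `W^n(y | x)` on the pairs of joint type `c`. -/
def typeTrans (W : X → Y → ℝ) (c : X → Y → Fin (n + 1)) : ℝ := ∏ b, ∏ a, W a b ^ (c a b : ℕ)

/-- Let TV be the empirical distribution given by `c`. On this type P^n = V^n e^{−nA}, W^n = e^{−nB}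
and P^n W^n = T^n V^n e^{−nD}, where V^n(x|y) is `wordProb V y x`. Summing V^n and T^n to at most 1
bounds π and ∑_y πq. The bound on the minimum does not depend on `y`, so it factors out of the sum.
-/
lemma sum_typeProb_mul_le {P : X → ℝ} (hP : P ∈ stdSimplex ℝ X)
    {W : X → Y → ℝ} (hW : ∀ x, W x ∈ stdSimplex ℝ Y) (hn : 0 < n) {R K e M L : ℝ}
    (hL0 : 0 ≤ L) (hM : M ≤ Real.exp (n * R)) (hL : L ≤ Real.exp (n * K))
    (he : ∀ T ∈ stdSimplex ℝ Y, ∀ V : Y → X → ℝ, (∀ y, V y ∈ stdSimplex ℝ X) →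
      (∀ y x, P x * W x y = 0 → T y * V y x = 0) → e ≤ realObjective P W R K T V)
    (c : X → Y → Fin (n + 1)) :
    ∑ y : Fin n → Y, typeProb P y c * typeTrans W c *
        min 1 (M * typeProb P y c * min 1 (L * typeTrans W c)) ≤ Real.exp (-(n * e)) := by
  have hnR : (0 : ℝ) < n := by exact_mod_cast hn
  have hzero : (∀ y : Fin n → Y, typeProb P y c * typeTrans W c = 0) →
      ∑ y : Fin n → Y, typeProb P y c * typeTrans W c *
        min 1 (M * typeProb P y c * min 1 (L * typeTrans W c)) ≤ Real.exp (-(n * e)) := by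
    intro h
    simp only [h, zero_mul, Finset.sum_const_zero]
    exact (Real.exp_pos _).le
  by_cases hne : ∃ x y, jointType x y = c
  swap
  · refine hzero fun y => ?_
    rw [typeProb, Finset.filter_false_of_mem fun x _ h => hne ⟨x, y, h⟩]
    simp
  obtain ⟨x₀, y₀, hc₀⟩ := hne
  -- A type charging a letter pair of PW-probability zero contributes nothing; the others satisfy TV
  -- ≪ PW, so `he` applies.
  by_cases hac : ∀ b a, P a * W a b = 0 → (c a b : ℕ) = 0
  swap
  · push Not at hac
    obtain ⟨b, a, hPW, hcab⟩ := hac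
    refine hzero fun y => ?_
    rcases mul_eq_zero.1 hPW with h | h
    · have : typeProb P y c = 0 := by
        refine Finset.sum_eq_zero fun x hx => ?_
        rw [← (Finset.mem_filter.1 hx).2] at hcab
        obtain ⟨i, hi, -⟩ := exists_of_jointType_pos (Nat.pos_of_ne_zero hcab)
        exact Finset.prod_eq_zero (Finset.mem_univ i) (by rw [hi, h])
      rw [this, zero_mul]
    · have : typeTrans W c = 0 :=
        Finset.prod_eq_zero (Finset.mem_univ b) (Finset.prod_eq_zero (Finset.mem_univ a)
          (by rw [h, zero_pow hcab]))
      rw [this, mul_zero]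
  set T := typeOut c with hT
  set V := typeCond P c with hV
  have hTm : T ∈ stdSimplex ℝ Y := by rw [hT, ← hc₀]; exact typeOut_mem hn x₀ y₀
  have hVm : ∀ y, V y ∈ stdSimplex ℝ X := typeCond_mem hP c
  have hTV : ∀ a b, T b * V b a = ((c a b : ℕ) : ℝ) / n := fun a b =>
    typeOut_mul_typeCond P c a b
  have hobj := he T hTm V hVm fun y x h => by rw [hTV, hac y x h]; simp
  have hpos : ∀ {x : Fin n → X} {y : Fin n → Y}, jointType x y = c → ∀ i,
      0 < P (x i) ∧ 0 < W (x i) (y i) ∧ 0 < T (y i) ∧ 0 < V (y i) (x i) := by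
    intro x y hxy i
    have h1 := jointType_pos x y i
    rw [hxy] at h1
    have h2 : P (x i) * W (x i) (y i) ≠ 0 := fun h => h1.ne' (hac _ _ h)
    have h3 : T (y i) * V (y i) (x i) ≠ 0 := by
      rw [hTV]
      exact (div_pos (by exact_mod_cast h1) hnR).ne'
    exact ⟨lt_of_le_of_ne (hP.1 _) (left_ne_zero_of_mul h2).symm,
      lt_of_le_of_ne ((hW _).1 _) (right_ne_zero_of_mul h2).symm,
      lt_of_le_of_ne (hTm.1 _) (left_ne_zero_of_mul h3).symm,
      lt_of_le_of_ne ((hVm _).1 _) (right_ne_zero_of_mul h3).symm⟩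
  have hsum : ∀ {x : Fin n → X} {y : Fin n → Y}, jointType x y = c → ∀ f : X → Y → ℝ,
      ∑ i, f (x i) (y i) = n * jointMean T V f :=
    fun hxy f => sum_eq_mul_jointMean hn P hxy f
  set A := jointMean T V (llrCond P V) with hA
  set B := jointMean T V (fun x y => -Real.log (W x y)) with hB
  set D := jointMean T V (llrJoint P W T V) with hD
  have hq : ∀ {x : Fin n → X} {y : Fin n → Y}, jointType x y = c →
      wordProb W x y = typeTrans W c := by
    intro x y hxy
    rw [wordProb, prod_eq_prod_jointType x y W, hxy, typeTrans]
  have hqB : typeTrans W c = Real.exp (-(n * B)) := by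
    rw [← hq hc₀, wordProb, prod_eq_prod_mul_exp _ (v := fun _ => 1)
      (fun i _ => (hpos hc₀ i).2.1) (fun _ _ => one_pos), Finset.prod_const_one, one_mul, hB,
      ← hsum hc₀]
    simp
  have hπA : ∀ y : Fin n → Y, typeProb P y c ≤ Real.exp (-(n * A)) := by
    intro y
    have h1 : typeProb P y c
        = ∑ x with jointType x y = c, wordProb V y x * Real.exp (-(n * A)) := by
      refine Finset.sum_congr rfl fun x hx => ?_
      have hxy := (Finset.mem_filter.1 hx).2
      rw [iid, prod_eq_prod_mul_exp _ (v := fun i => V (y i) (x i))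
        (fun i _ => (hpos hxy i).1) (fun i _ => (hpos hxy i).2.2.2), hA, ← hsum hxy]
      rfl
    rw [h1, ← Finset.sum_mul]
    refine mul_le_of_le_one_left (Real.exp_pos _).le ?_
    rw [← sum_wordProb hVm y]
    exact Finset.sum_le_sum_of_subset_of_nonneg (Finset.filter_subset _ _)
      fun x _ _ => wordProb_nonneg hVm y x
  have hD' : ∑ y : Fin n → Y, typeProb P y c * typeTrans W c ≤ Real.exp (-(n * D)) := by
    have h1 : ∀ y : Fin n → Y, typeProb P y c * typeTrans W c
        ≤ iid T y * Real.exp (-(n * D)) := by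
      intro y
      have h2 : typeProb P y c * typeTrans W c
          = ∑ x with jointType x y = c, wordProb V y x * (iid T y * Real.exp (-(n * D))) := by
        rw [typeProb, Finset.sum_mul]
        refine Finset.sum_congr rfl fun x hx => ?_
        have hxy := (Finset.mem_filter.1 hx).2
        rw [← hq hxy, iid, wordProb, ← Finset.prod_mul_distrib,
          prod_eq_prod_mul_exp _ (v := fun i => T (y i) * V (y i) (x i))
          (fun i _ => mul_pos (hpos hxy i).1 (hpos hxy i).2.1)
          (fun i _ => mul_pos (hpos hxy i).2.2.1 (hpos hxy i).2.2.2), hD, ← hsum hxy,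
          Finset.prod_mul_distrib, wordProb, iid]
        simp only [llrJoint]
        ring
      rw [h2, ← Finset.sum_mul]
      refine mul_le_of_le_one_left (mul_nonneg (iid_nonneg hTm.1 y) (Real.exp_pos _).le) ?_
      rw [← sum_wordProb hVm y]
      exact Finset.sum_le_sum_of_subset_of_nonneg (Finset.filter_subset _ _)
        fun x _ _ => wordProb_nonneg hVm y x
    refine (Finset.sum_le_sum fun y _ => h1 y).trans (le_of_eq ?_)
    rw [← Finset.sum_mul, sum_iid hTm.2, one_mul]
  have hq0 : 0 ≤ typeTrans W c := by rw [hqB]; exact (Real.exp_pos _).le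
  have hπ0 : ∀ y : Fin n → Y, 0 ≤ typeProb P y c := fun y =>
    Finset.sum_nonneg fun x _ => iid_nonneg hP.1 x
  have hmin : ∀ y : Fin n → Y, min 1 (M * typeProb P y c * min 1 (L * typeTrans W c))
      ≤ Real.exp (-(n * max 0 (A - R + max 0 (B - K)))) := by
    intro y
    rw [exp_neg_mul_max_zero hnR.le]
    refine min_le_min le_rfl ?_
    have e1 : Real.exp (-(n * (A - R + max 0 (B - K))))
        = Real.exp (n * R) * Real.exp (-(n * A)) * min 1 (Real.exp (n * K) * Real.exp (-(n * B))) := by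
      rw [← Real.exp_add, ← Real.exp_add,
        show (n : ℝ) * K + -(n * B) = -(n * (B - K)) by ring, ← exp_neg_mul_max_zero hnR.le,
        ← Real.exp_add]
      congr 1; ring
    rw [e1]
    refine mul_le_mul (mul_le_mul hM (hπA y) (hπ0 y) (Real.exp_pos _).le)
      (min_le_min le_rfl ?_) (le_min zero_le_one (mul_nonneg hL0 hq0)) (by positivity)
    rw [hqB]
    exact mul_le_mul_of_nonneg_right hL (Real.exp_pos _).le
  calc _ ≤ ∑ y : Fin n → Y, typeProb P y c * typeTrans W c *
        Real.exp (-(n * max 0 (A - R + max 0 (B - K)))) :=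
      Finset.sum_le_sum fun y _ => mul_le_mul_of_nonneg_left (hmin y) (mul_nonneg (hπ0 y) hq0)
    _ ≤ Real.exp (-(n * D)) * Real.exp (-(n * max 0 (A - R + max 0 (B - K)))) := by
      rw [← Finset.sum_mul]
      exact mul_le_mul_of_nonneg_right hD' (Real.exp_pos _).le
    _ = Real.exp (-(n * realObjective P W R K T V)) := by
      rw [← Real.exp_add, realObjective]; congr 1; ring
    _ ≤ _ := Real.exp_le_exp.2 (neg_le_neg (mul_le_mul_of_nonneg_left hobj hnR.le))

end Types

lemma expSize_pos {n : ℕ} {r : ℝ} (hr : 0 < r) : 0 < expSize n r :=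
  Nat.floor_pos.2 (Real.one_le_exp (by positivity))

lemma expSize_le (n : ℕ) (r : ℝ) : (expSize n r : ℝ) ≤ Real.exp (n * r) :=
  Nat.floor_le (Real.exp_pos _).le

/-- Non-asymptotic upper bound on the average error probability. -/
theorem avgError_le [DecidableEq Y] {P : X → ℝ} (hP : P ∈ stdSimplex ℝ X)
    {W : X → Y → ℝ} (hW : ∀ x, W x ∈ stdSimplex ℝ Y) {R K e : ℝ} (hR : 0 < R) (hK : 0 < K)
    {n : ℕ} (hn : 0 < n) {δ : Decoder X Y n (expSize n R) (expSize n K)} (hδ : IsMLDecoder δ)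
    (he : ∀ T ∈ stdSimplex ℝ Y, ∀ V : Y → X → ℝ, (∀ y, V y ∈ stdSimplex ℝ X) →
      (∀ y x, P x * W x y = 0 → T y * V y x = 0) → e ≤ realObjective P W R K T V) :
    avgError P W δ
      ≤ (((n + 1 : ℕ) : ℝ) ^ (Fintype.card Y * Fintype.card X)) ^ 2 * Real.exp (-(n * e)) := by
  classical
  have hM := expSize_pos (n := n) hR
  have hL := expSize_pos (n := n) hK
  set C : ℝ := ((n + 1 : ℕ) : ℝ) ^ (Fintype.card Y * Fintype.card X) with hC
  have hcard : (Fintype.card (X → Y → Fin (n + 1)) : ℝ) = C := by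
    simp [hC, pow_mul]
  have hMR : (0 : ℝ) < expSize n R := by exact_mod_cast hM
  have hLR : (0 : ℝ) < expSize n K := by exact_mod_cast hL
  have h1 : ∀ y : Fin n → Y, mean (iid (msgWeight P W)) (errorCount δ y)
      ≤ C * ∑ c, expSize n R * typeProb P y c * (expSize n K * typeTrans W c) *
        min 1 (expSize n R * typeProb P y c * min 1 (expSize n K * typeTrans W c)) := by
    intro y
    rw [← hcard]
    exact mean_errorCount_le_classes hP hW hδ hL y (fun x => jointType x y) (typeTrans W)
      (fun c => Finset.prod_nonneg fun b _ => Finset.prod_nonneg fun a _ =>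
        pow_nonneg ((hW a).1 b) _)
      (fun x => prod_eq_prod_jointType x y W) (typeProb P y) (fun c => rfl)
  rw [avgError_eq]
  calc _ ≤ 1 / ((expSize n R : ℝ) * expSize n K) * ∑ y : Fin n → Y, C * ∑ c,
        expSize n R * typeProb P y c * (expSize n K * typeTrans W c) *
        min 1 (expSize n R * typeProb P y c * min 1 (expSize n K * typeTrans W c)) :=
      mul_le_mul_of_nonneg_left (Finset.sum_le_sum fun y _ => h1 y) (by positivity)
    _ = C * ∑ c, ∑ y : Fin n → Y, typeProb P y c * typeTrans W c *
        min 1 (expSize n R * typeProb P y c * min 1 (expSize n K * typeTrans W c)) := by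
      rw [← Finset.mul_sum, Finset.sum_comm, ← mul_assoc, mul_comm _ C, mul_assoc]
      congr 1
      rw [Finset.mul_sum]
      refine Finset.sum_congr rfl fun c _ => ?_
      rw [Finset.mul_sum]
      refine Finset.sum_congr rfl fun y _ => ?_
      field_simp
    _ ≤ C * ∑ _c : X → Y → Fin (n + 1), Real.exp (-(n * e)) := by
      refine mul_le_mul_of_nonneg_left (Finset.sum_le_sum fun c _ => ?_) (by positivity)
      exact sum_typeProb_mul_le hP hW hn hLR.le (expSize_le n R) (expSize_le n K) he c
    _ = C ^ 2 * Real.exp (-(n * e)) := by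
      rw [Finset.sum_const, Finset.card_univ, nsmul_eq_mul, hcard]; ring

end

/-! ### Typical pairs and the lower bound on the error. -/

section

variable {X Y : Type*} [Fintype X] [Fintype Y]

/-- The joint distribution `T(y) V(x | y)`. -/
def joint (T : Y → ℝ) (V : Y → X → ℝ) (z : Y × X) : ℝ := T z.1 * V z.1 z.2

section Joint

variable {T : Y → ℝ} {V : Y → X → ℝ}

lemma joint_nonneg (hT : T ∈ stdSimplex ℝ Y) (hV : ∀ y, V y ∈ stdSimplex ℝ X) (z : Y × X) :
    0 ≤ joint T V z := mul_nonneg (hT.1 _) ((hV _).1 _)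

lemma sum_joint (hT : T ∈ stdSimplex ℝ Y) (hV : ∀ y, V y ∈ stdSimplex ℝ X) :
    ∑ z, joint T V z = 1 := by
  simp only [joint, Fintype.sum_prod_type, ← Finset.mul_sum, (hV _).2, mul_one, hT.2]

lemma mean_joint (f : X → Y → ℝ) : mean (joint T V) (fun z => f z.2 z.1) = jointMean T V f := by
  simp only [mean, joint, jointMean, Fintype.sum_prod_type]

/-- Pairs of words for which the empirical mean of `f` is within `ε` of its expectation. -/
def IsClose (T : Y → ℝ) (V : Y → X → ℝ) (ε : ℝ) {n : ℕ} (f : X → Y → ℝ)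
    (x : Fin n → X) (y : Fin n → Y) : Prop :=
  |∑ i, f (x i) (y i) - n * jointMean T V f| ≤ n * ε

-- Chebyshev's inequality; `s` is the variance of one letter, so it depends on neither ε nor n.
open Classical in
lemma mean_not_isClose_le (hT : T ∈ stdSimplex ℝ Y) (hV : ∀ y, V y ∈ stdSimplex ℝ X)
    (f : X → Y → ℝ) :
    ∃ s : ℝ, ∀ ε > 0, ∀ n : ℕ, 0 < n →
      mean (iid (joint T V)) (fun z : Fin n → Y × X =>
        if IsClose T V ε f (fun i => (z i).2) (fun i => (z i).1) then (0 : ℝ) else 1)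
        ≤ s / (n * ε ^ 2) := by
  have hs := sum_joint hT hV
  have h0 := joint_nonneg hT hV
  set F := jointMean T V f with hF
  set h : Y × X → ℝ := fun z => f z.2 z.1 - F with hh
  have hmean : mean (joint T V) h = 0 := by
    simp only [hh]
    rw [mean_sub, mean_joint, ← hF]
    simp [mean, ← Finset.sum_mul, hs]
  refine ⟨mean (joint T V) (fun z => h z ^ 2), fun ε hε n hn => ?_⟩
  have hn' : (0 : ℝ) < n := by exact_mod_cast hn
  have hcheb := mean_sum_sq (ι := Fin n) hs hmean
  have hpt : ∀ z : Fin n → Y × X,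
      (if IsClose T V ε f (fun i => (z i).2) (fun i => (z i).1) then (0 : ℝ) else 1)
        ≤ 1 / (n * ε) ^ 2 * (∑ i, h (z i)) ^ 2 := by
    intro z
    split_ifs with hc
    · positivity
    · have e : ∑ i, h (z i) = ∑ i, f (z i).2 (z i).1 - n * F := by
        simp [hh, Finset.sum_sub_distrib]
      rw [IsClose, not_le, ← hF, ← e] at hc
      rw [one_div_mul_eq_div, one_le_div (by positivity), ← sq_abs (∑ i, h (z i))]
      exact pow_le_pow_left₀ (by positivity) hc.le 2
  refine (mean_mono (iid_nonneg h0) hpt).trans (le_of_eq ?_)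
  rw [mean_const_mul, hcheb, Fintype.card_fin]
  field_simp

lemma mean_iid_joint {n : ℕ} (g : (Fin n → X) → (Fin n → Y) → ℝ) :
    mean (iid (joint T V)) (fun z : Fin n → Y × X => g (fun i => (z i).2) (fun i => (z i).1))
      = ∑ y, iid T y * ∑ x, wordProb V y x * g x y := by
  rw [mean, ← (Equiv.arrowProdEquivProdArrow (Fin n) (fun _ => Y)
    (fun _ => X)).symm.sum_comp, Fintype.sum_prod_type]
  refine Finset.sum_congr rfl fun y _ => ?_
  rw [Finset.mul_sum]
  refine Finset.sum_congr rfl fun x _ => ?_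
  rw [← mul_assoc]
  congr 1
  simp only [iid, joint, wordProb, ← Finset.prod_mul_distrib]
  rfl

/-- Pairs of words in the support of `TV` that are typical for the three log-likelihoods. -/
def IsTypical (P : X → ℝ) (W : X → Y → ℝ) (T : Y → ℝ) (V : Y → X → ℝ) (ε : ℝ) {n : ℕ}
    (x : Fin n → X) (y : Fin n → Y) : Prop :=
  (∀ i, 0 < T (y i) * V (y i) (x i)) ∧ IsClose T V ε (llrCond P V) x y ∧
    IsClose T V ε (fun x y => -Real.log (W x y)) x y ∧ IsClose T V ε (llrJoint P W T V) x y

open Classical in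
/-- Indicator function of the typical pairs. -/
def typicalInd (P : X → ℝ) (W : X → Y → ℝ) (T : Y → ℝ) (V : Y → X → ℝ) (ε : ℝ) {n : ℕ}
    (x : Fin n → X) (y : Fin n → Y) : ℝ := if IsTypical P W T V ε x y then 1 else 0

lemma eventually_half_le_mean_typicalInd (P : X → ℝ) (W : X → Y → ℝ)
    (hT : T ∈ stdSimplex ℝ Y) (hV : ∀ y, V y ∈ stdSimplex ℝ X) {ε : ℝ} (hε : 0 < ε) :
    ∀ᶠ n : ℕ in atTop, 1 / 2 ≤ ∑ y : Fin n → Y, iid T y *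
      ∑ x, wordProb V y x * typicalInd P W T V ε x y := by
  classical
  obtain ⟨s₁, h₁⟩ := mean_not_isClose_le hT hV (llrCond P V)
  obtain ⟨s₂, h₂⟩ := mean_not_isClose_le hT hV (fun x y => -Real.log (W x y))
  obtain ⟨s₃, h₃⟩ := mean_not_isClose_le hT hV (llrJoint P W T V)
  have hlim : Tendsto (fun n : ℕ => (s₁ + s₂ + s₃) / ε ^ 2 / (n : ℝ)) atTop (𝓝 0) :=
    tendsto_const_div_atTop_nhds_zero_nat _
  filter_upwards [eventually_gt_atTop 0, hlim.eventually_le_const (show (0 : ℝ) < 1 / 2 by norm_num)]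
    with n hn hle
  have hs := sum_joint hT hV
  have h0 := joint_nonneg hT hV
  have g₁ := h₁ ε hε n hn
  have g₂ := h₂ ε hε n hn
  have g₃ := h₃ ε hε n hn
  rw [← mean_iid_joint]
  set ind : (X → Y → ℝ) → (Fin n → Y × X) → ℝ := fun f z =>
    if IsClose T V ε f (fun i => (z i).2) (fun i => (z i).1) then (0 : ℝ) else 1 with hind
  -- Union bound over the three deviation events. The support condition costs nothing, because pairs
  -- violating it have weight zero.
  have hpt : mean (iid (joint T V)) (fun z : Fin n → Y × X =>
        1 - (ind (llrCond P V) z + ind (fun x y => -Real.log (W x y)) z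
          + ind (llrJoint P W T V) z))
      ≤ mean (iid (joint T V)) (fun z : Fin n → Y × X =>
        typicalInd P W T V ε (fun i => (z i).2) (fun i => (z i).1)) := by
    refine Finset.sum_le_sum fun z _ => ?_
    by_cases hz : ∀ i, 0 < T (z i).1 * V (z i).1 (z i).2
    · refine mul_le_mul_of_nonneg_left ?_ (iid_nonneg h0 z)
      have hi0 : ∀ f, 0 ≤ ind f z := fun f => by simp only [hind]; split_ifs <;> norm_num
      have hi1 : ∀ f, ¬ IsClose T V ε f (fun i => (z i).2) (fun i => (z i).1) → ind f z = 1 :=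
        fun f hf => by simp only [hind, if_neg hf]
      have a1 := hi0 (llrCond P V)
      have a2 := hi0 (fun x y => -Real.log (W x y))
      have a3 := hi0 (llrJoint P W T V)
      simp only [typicalInd]
      split_ifs with ht
      · linarith
      · by_cases c1 : IsClose T V ε (llrCond P V) (fun i => (z i).2) (fun i => (z i).1)
        swap
        · have := hi1 _ c1; linarith
        by_cases c2 : IsClose T V ε (fun x y => -Real.log (W x y)) (fun i => (z i).2)
            (fun i => (z i).1)
        swap
        · have := hi1 _ c2; linarith
        by_cases c3 : IsClose T V ε (llrJoint P W T V) (fun i => (z i).2) (fun i => (z i).1)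
        swap
        · have := hi1 _ c3; linarith
        exact absurd ⟨hz, c1, c2, c3⟩ ht
    · push Not at hz
      obtain ⟨i, hi⟩ := hz
      have : iid (joint T V) z = 0 :=
        Finset.prod_eq_zero (Finset.mem_univ i) (le_antisymm hi (h0 _))
      simp [this]
  refine le_trans ?_ hpt
  rw [mean_sub, mean_add, mean_add]
  have hone : mean (iid (joint T V)) (fun _ : Fin n → Y × X => (1 : ℝ)) = 1 := by
    simp [mean, sum_iid hs]
  rw [hone]
  have hn' : (0 : ℝ) < n := by exact_mod_cast hn
  have e : (s₁ + s₂ + s₃) / ε ^ 2 / (n : ℝ)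
      = s₁ / (n * ε ^ 2) + s₂ / (n * ε ^ 2) + s₃ / (n * ε ^ 2) := by field_simp
  simp only [hind]
  linarith

end Joint

lemma half_exp_le_expSize {n : ℕ} {r : ℝ} (hr : 0 < r) :
    Real.exp (n * r) / 2 ≤ expSize n r := by
  have h1 : (1 : ℝ) ≤ expSize n r := by exact_mod_cast expSize_pos (n := n) hr
  have h2 : Real.exp (n * r) < expSize n r + 1 := Nat.lt_floor_add_one _
  linarith

lemma two_le_expSize {n : ℕ} {r : ℝ} (h : 1 ≤ n * r) : 2 ≤ expSize n r := by
  refine Nat.le_floor ?_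
  have := Real.add_one_le_exp (n * r)
  push_cast
  linarith

section Lower

variable {P : X → ℝ} {W : X → Y → ℝ} {T : Y → ℝ} {V : Y → X → ℝ} {ε : ℝ} {n : ℕ}

lemma IsTypical.pos (hP : P ∈ stdSimplex ℝ X) (hW : ∀ x, W x ∈ stdSimplex ℝ Y)
    (hT : T ∈ stdSimplex ℝ Y) (hV : ∀ y, V y ∈ stdSimplex ℝ X)
    (hac : ∀ y x, P x * W x y = 0 → T y * V y x = 0)
    {x : Fin n → X} {y : Fin n → Y} (h : IsTypical P W T V ε x y) (i : Fin n) :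
    0 < P (x i) ∧ 0 < W (x i) (y i) ∧ 0 < T (y i) ∧ 0 < V (y i) (x i) := by
  have h3 := (h.1 i).ne'
  have h2 : P (x i) * W (x i) (y i) ≠ 0 := fun h' => h3 (hac _ _ h')
  exact ⟨lt_of_le_of_ne (hP.1 _) (left_ne_zero_of_mul h2).symm,
    lt_of_le_of_ne ((hW _).1 _) (right_ne_zero_of_mul h2).symm,
    lt_of_le_of_ne (hT.1 _) (left_ne_zero_of_mul h3).symm,
    lt_of_le_of_ne ((hV _).1 _) (right_ne_zero_of_mul h3).symm⟩

lemma wordProb_eq_exp {x : Fin n → X} {y : Fin n → Y} (h : ∀ i, 0 < W (x i) (y i)) :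
    wordProb W x y = Real.exp (-∑ i, -Real.log (W (x i) (y i))) := by
  rw [wordProb, prod_eq_prod_mul_exp _ (v := fun _ => 1) (fun i _ => h i)
    (fun _ _ => one_pos), Finset.prod_const_one, one_mul]
  simp

/-- Monotonicity and concavity of `ν ↦ ν / (c + b ν)` combined. -/
lemma mul_div_add_le {ν v z c b : ℝ} (hv1 : v ≤ 1) (hz : 0 < z) (hc : 0 < c)
    (hb : 0 ≤ b) (hν : v * z ≤ ν) (hν0 : 0 ≤ ν) : v * z / (c + b * z) ≤ ν / (c + b * ν) := by
  rw [div_le_div_iff₀ (by positivity) (by positivity)]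
  have h1 := mul_le_mul_of_nonneg_right hν hc.le
  have h2 : v * (z * b * ν) ≤ 1 * (z * b * ν) :=
    mul_le_mul_of_nonneg_right hv1 (by positivity)
  nlinarith

/-- Typicality gives two lower bounds on the mean ν(y) of W^n(y|x) over typical codewords: v·z by
changing measure from P to V, and T^n(y)·v·e by changing from PW to TV, where v(y) is the V^n-mass
of words typical with `y`. Using each once in ν²/(c + MLν) makes e produce D and z produce the
positive parts. `hnR` ensures at least two messages. -/
theorem avgError_ge [DecidableEq Y] (hP : P ∈ stdSimplex ℝ X)
    (hW : ∀ x, W x ∈ stdSimplex ℝ Y) {R K : ℝ} (hR : 0 < R) (hK : 0 < K)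
    (hT : T ∈ stdSimplex ℝ Y) (hV : ∀ y, V y ∈ stdSimplex ℝ X)
    (hac : ∀ y x, P x * W x y = 0 → T y * V y x = 0)
    (hnR : 1 ≤ n * R) (hε : 0 ≤ ε)
    (htyp : 1 / 2 ≤ ∑ y : Fin n → Y, iid T y *
      ∑ x, wordProb V y x * typicalInd P W T V ε x y)
    {δ : Decoder X Y n (expSize n R) (expSize n K)} (hδ : IsMLDecoder δ) :
    1 / 208 * Real.exp (-(n * (realObjective P W R K T V + 4 * ε))) ≤ avgError P W δ := by
  have hMn := expSize_pos (n := n) hR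
  have hLn := expSize_pos (n := n) hK
  have hM2 : (2 : ℝ) ≤ expSize n R := by exact_mod_cast two_le_expSize hnR
  have hLpos : (0 : ℝ) < expSize n K := by exact_mod_cast hLn
  have hMge := half_exp_le_expSize (n := n) hR
  have hLge := half_exp_le_expSize (n := n) hK
  have hmain := fun y (g : (Fin n → X) → ℝ) hg0 hg1 b hb hgb ν hν =>
    le_mean_errorCount (b := b) (ν := ν) hP hW hδ hLn hMn y g hg0 hg1 hb hgb hν
  rw [avgError_eq]
  set M : ℝ := (expSize n R : ℝ) with hM
  set L : ℝ := (expSize n K : ℝ) with hL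
  set A := jointMean T V (llrCond P V) with hA
  set B := jointMean T V (fun x y => -Real.log (W x y)) with hB
  set D := jointMean T V (llrJoint P W T V) with hD
  set G := max 0 (A - R + max 0 (B - K)) with hG
  set g : (Fin n → X) → (Fin n → Y) → ℝ := typicalInd P W T V ε with hg
  set qb := Real.exp (-(n * (B - ε))) with hqb
  set z := Real.exp (-(n * (A + B + 2 * ε))) with hz
  set e := Real.exp (-(n * (D + ε))) with he
  have hg0 : ∀ x y, 0 ≤ g x y := fun x y => by
    simp only [hg, typicalInd]; split_ifs <;> norm_num
  have hg1 : ∀ x y, g x y ≤ 1 := fun x y => by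
    simp only [hg, typicalInd]; split_ifs <;> norm_num
  have hcase : ∀ {x y} {F : ℝ}, 0 ≤ F → ∀ {H : ℝ},
      (IsTypical P W T V ε x y → H ≤ F) → g x y * H ≤ F := by
    intro x y F hF H h
    simp only [hg, typicalInd]
    split_ifs with ht
    · simpa using h ht
    · simpa using hF
  have hcase' : ∀ {x y} {F H : ℝ},
      (IsTypical P W T V ε x y → H ≤ F) → H * g x y ≤ g x y * F := by
    intro x y F H h
    simp only [hg, typicalInd]
    split_ifs with ht
    · simpa using h ht
    · simp
  set v : (Fin n → Y) → ℝ := fun y => ∑ x, wordProb V y x * g x y with hv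
  set ν : (Fin n → Y) → ℝ := fun y => ∑ x, iid P x * (g x y * wordProb W x y) with hν
  have hT0 : ∀ y : Fin n → Y, 0 ≤ iid T y := iid_nonneg hT.1
  have hv0 : ∀ y, 0 ≤ v y := fun y => Finset.sum_nonneg fun x _ =>
    mul_nonneg (wordProb_nonneg hV y x) (hg0 x y)
  have hv1 : ∀ y, v y ≤ 1 := fun y => by
    rw [← sum_wordProb hV y]
    exact Finset.sum_le_sum fun x _ => mul_le_of_le_one_right (wordProb_nonneg hV y x) (hg1 x y)
  have hν0 : ∀ y, 0 ≤ ν y := fun y => Finset.sum_nonneg fun x _ =>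
    mul_nonneg (iid_nonneg hP.1 x) (mul_nonneg (hg0 x y) (wordProb_nonneg hW x y))
  have hgb : ∀ x y, g x y * wordProb W x y ≤ qb := by
    intro x y
    refine hcase (Real.exp_pos _).le fun ht => ?_
    rw [wordProb_eq_exp fun i => (ht.pos hP hW hT hV hac i).2.1]
    refine Real.exp_le_exp.2 ?_
    have := (abs_le.1 ht.2.2.1).1
    rw [← hB] at this
    linarith
  have hνz : ∀ y, v y * z ≤ ν y := by
    intro y
    simp only [hv, hν, Finset.sum_mul]
    refine Finset.sum_le_sum fun x _ => ?_
    rw [mul_right_comm, mul_left_comm]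
    refine hcase' fun ht => ?_
    have hpos := ht.pos hP hW hT hV hac
    have a1 := (abs_le.1 ht.2.1).2
    have a2 := (abs_le.1 ht.2.2.1).2
    rw [← hA] at a1
    rw [← hB] at a2
    rw [wordProb_eq_exp fun i => (hpos i).2.1, iid, prod_eq_prod_mul_exp _
      (v := fun i => V (y i) (x i)) (fun i _ => (hpos i).1) (fun i _ => (hpos i).2.2.2),
      mul_assoc, ← Real.exp_add]
    refine mul_le_mul_of_nonneg_left (Real.exp_le_exp.2 ?_) (wordProb_nonneg hV y x)
    simp only [llrCond] at a1
    linarith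
  have hνe : ∀ y, iid T y * v y * e ≤ ν y := by
    intro y
    simp only [hv, hν, Finset.mul_sum, Finset.sum_mul]
    refine Finset.sum_le_sum fun x _ => ?_
    rw [← mul_assoc, mul_right_comm, mul_left_comm (iid P x)]
    refine hcase' fun ht => ?_
    have hpos := ht.pos hP hW hT hV hac
    have a1 := (abs_le.1 ht.2.2.2).2
    rw [← hD] at a1
    rw [iid, iid, wordProb, wordProb, ← Finset.prod_mul_distrib, ← Finset.prod_mul_distrib,
      prod_eq_prod_mul_exp _ (u := fun i => P (x i) * W (x i) (y i))
      (v := fun i => T (y i) * V (y i) (x i)) (fun i _ => mul_pos (hpos i).1 (hpos i).2.1)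
      (fun i _ => ht.1 i)]
    refine mul_le_mul_of_nonneg_left (Real.exp_le_exp.2 ?_)
      (Finset.prod_nonneg fun i _ => (ht.1 i).le)
    simp only [llrJoint] at a1
    linarith
  -- Both lower bounds on ν carry a factor v, so the second moment of v is needed; it is at least
  -- the square of its mean.
  have hCS : 1 / 4 ≤ ∑ y : Fin n → Y, iid T y * v y ^ 2 := by
    have h := Finset.sum_mul_sq_le_sq_mul_sq Finset.univ (fun y : Fin n → Y => √(iid T y))
      (fun y => √(iid T y) * v y)
    simp only [← mul_assoc, Real.mul_self_sqrt (hT0 _), Real.sq_sqrt (hT0 _), mul_pow,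
      sum_iid hT.2, one_mul] at h
    refine le_trans ?_ h
    have : (1 / 2 : ℝ) ^ 2 ≤ (∑ y : Fin n → Y, iid T y * v y) ^ 2 :=
      pow_le_pow_left₀ (by norm_num) htyp 2
    linarith
  have hzpos : 0 < z := Real.exp_pos _
  have hepos : 0 < e := Real.exp_pos _
  have hqpos : 0 < qb := Real.exp_pos _
  have hMpos : 0 < M := by linarith
  set c := 2 + 2 * L * qb with hc
  have hcpos : 0 < c := by positivity
  have hperY : ∀ y, M * (M - 1) * L ^ 2 / 2 * (e * z / (c + M * L * z)) * (iid T y * v y ^ 2)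
      ≤ mean (iid (msgWeight P W)) (errorCount δ y) := by
    intro y
    refine le_trans ?_ (hmain y (fun x => g x y) (fun x => hg0 x y) (fun x => hg1 x y) qb hqpos.le
      (fun x => hgb x y) (ν y) rfl)
    have h1 := mul_div_add_le (hv1 y) hzpos hcpos (mul_pos hMpos hLpos).le (hνz y) (hν0 y)
    have h2 := mul_le_mul (hνe y) h1
      (div_nonneg (mul_nonneg (hv0 y) hzpos.le) (by positivity)) (hν0 y)
    have h3 : 0 ≤ M * (M - 1) * L ^ 2 / 2 :=
      div_nonneg (mul_nonneg (mul_nonneg hMpos.le (by linarith)) (sq_nonneg _)) (by norm_num)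
    have h4 := mul_le_mul_of_nonneg_left h2 h3
    calc _ = M * (M - 1) * L ^ 2 / 2 * (iid T y * v y * e * (v y * z / (c + M * L * z))) := by ring
      _ ≤ _ := h4
      _ = _ := by
        have := hν0 y
        have : c + M * L * ν y ≠ 0 := by positivity
        field_simp
        rw [hc]
        ring
  -- 13 = 8 + 4 + 1, one number for each of 2, 2L·qb and MLz; the powers of 2 include the halves
  -- lost to the floors of M and L. The slack 3ε pays for 2ε in `z` and ε in `qb`.
  have hEbig : c + M * L * z ≤ 13 * Real.exp (n * (G + 3 * ε)) * (M * L * z) := by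
    set E := Real.exp (n * (G + 3 * ε)) with hE
    have hn0 : (0 : ℝ) ≤ n := Nat.cast_nonneg _
    have hG0 : 0 ≤ G := le_max_left _ _
    have hGA : A - R ≤ G := le_trans (by linarith [le_max_left 0 (B - K)]) (le_max_right _ _)
    have hGB : A - R + (B - K) ≤ G :=
      le_trans (by linarith [le_max_right 0 (B - K)]) (le_max_right _ _)
    have hE1 : 1 ≤ E := Real.one_le_exp (by positivity)
    have b1 : 1 ≤ E * (Real.exp (n * R) * Real.exp (n * K) * z) := by
      rw [hE, hz, ← Real.exp_add, ← Real.exp_add, ← Real.exp_add]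
      refine Real.one_le_exp ?_
      have : 0 ≤ (n : ℝ) * (G - (A - R + (B - K)) + ε) :=
        mul_nonneg hn0 (by linarith)
      linarith
    have b2 : qb ≤ E * (Real.exp (n * R) * z) := by
      rw [hE, hz, hqb, ← Real.exp_add, ← Real.exp_add]
      refine Real.exp_le_exp.2 ?_
      have : 0 ≤ (n : ℝ) * (G - (A - R)) := mul_nonneg hn0 (by linarith)
      linarith
    have b3 : Real.exp (n * R) * Real.exp (n * K) ≤ 4 * (M * L) := by
      have := mul_le_mul hMge hLge (by positivity) hMpos.le
      linarith
    have d1 : 2 ≤ 8 * E * (M * L * z) := by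
      have := mul_le_mul_of_nonneg_left (mul_le_mul_of_nonneg_right b3 hzpos.le)
        (zero_le_one.trans hE1)
      linarith
    have d2 : 2 * L * qb ≤ 4 * E * (M * L * z) := by
      have h1 : qb ≤ E * (2 * M * z) := b2.trans (mul_le_mul_of_nonneg_left
        (mul_le_mul_of_nonneg_right (by linarith) hzpos.le) (zero_le_one.trans hE1))
      have := mul_le_mul_of_nonneg_left h1 (show 0 ≤ 2 * L by positivity)
      linarith
    have d3 : M * L * z ≤ E * (M * L * z) := le_mul_of_one_le_left (by positivity) hE1
    rw [hc]
    linarith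
  have hfrac : 1 / 13 * Real.exp (-(n * (G + 3 * ε))) ≤ M * L * z / (c + M * L * z) := by
    rw [le_div_iff₀ (by positivity), Real.exp_neg]
    have h1 := mul_le_mul_of_nonneg_left hEbig
      (show 0 ≤ 1 / 13 * (Real.exp (n * (G + 3 * ε)))⁻¹ by positivity)
    refine h1.trans (le_of_eq ?_)
    field_simp
  -- 208 = 16 · 13, where 1/16 collects 1/2 from the second-moment bound, 1/4 from `hCS` and 1/2
  -- from M − 1 ≥ M/2. The slack 4ε is ε from `e` plus 3ε.
  calc 1 / 208 * Real.exp (-(n * (realObjective P W R K T V + 4 * ε)))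
      = 1 / 16 * e * (1 / 13 * Real.exp (-(n * (G + 3 * ε)))) := by
        have : -(n * (realObjective P W R K T V + 4 * ε))
            = -(n * (D + ε)) + -(n * (G + 3 * ε)) := by
          rw [realObjective]; ring
        rw [this, Real.exp_add]; ring
    _ ≤ 1 / 16 * e * (M * L * z / (c + M * L * z)) :=
        mul_le_mul_of_nonneg_left hfrac (by positivity)
    _ = (M / 2) * (L * e * z / (8 * (c + M * L * z))) := by
        field_simp; norm_num
    _ ≤ (M - 1) * (L * e * z / (8 * (c + M * L * z))) :=
        mul_le_mul_of_nonneg_right (by linarith) (by positivity)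
    _ = 1 / (M * L) * (M * (M - 1) * L ^ 2 / 2 * (e * z / (c + M * L * z)) * (1 / 4)) := by
        field_simp; ring
    _ ≤ 1 / (M * L) * (M * (M - 1) * L ^ 2 / 2 * (e * z / (c + M * L * z)) *
          ∑ y : Fin n → Y, iid T y * v y ^ 2) := by
        have h3 : 0 ≤ M * (M - 1) * L ^ 2 / 2 :=
          div_nonneg (mul_nonneg (mul_nonneg hMpos.le (by linarith)) (sq_nonneg _)) (by norm_num)
        refine mul_le_mul_of_nonneg_left (mul_le_mul_of_nonneg_left hCS ?_) (by positivity)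
        exact mul_nonneg h3 (by positivity)
    _ ≤ _ := by
        rw [Finset.mul_sum]
        exact mul_le_mul_of_nonneg_left (Finset.sum_le_sum fun y _ => hperY y) (by positivity)

end Lower

end

/-! ### Attainment of the minimum and negligible prefactors. -/

section

variable {X Y : Type*} [Fintype X] [Fintype Y]

/-- Pairs `(T, V)` with `TV ≪ PW`. -/
def feasible (P : X → ℝ) (W : X → Y → ℝ) : Set ((Y → ℝ) × (Y → X → ℝ)) :=
  {p | p.1 ∈ stdSimplex ℝ Y ∧ (∀ y, p.2 y ∈ stdSimplex ℝ X) ∧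
    ∀ y x, P x * W x y = 0 → p.1 y * p.2 y x = 0}

/-- Absolute continuity is a family of polynomial equations in (T, V), hence closed. -/
lemma isCompact_feasible (P : X → ℝ) (W : X → Y → ℝ) : IsCompact (feasible P W) := by
  have h1 : IsCompact ((stdSimplex ℝ Y) ×ˢ (Set.univ.pi fun _ : Y => stdSimplex ℝ X)) :=
    (isCompact_stdSimplex ℝ Y).prod (isCompact_univ_pi fun _ => isCompact_stdSimplex ℝ X)
  have h2 : IsClosed {p : (Y → ℝ) × (Y → X → ℝ) |
      ∀ y x, P x * W x y = 0 → p.1 y * p.2 y x = 0} := by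
    simp only [Set.ofPred_forall]
    refine isClosed_iInter fun y => isClosed_iInter fun x => isClosed_iInter fun _ => ?_
    exact isClosed_eq (by fun_prop) continuous_const
  convert h1.inter_right h2 using 1
  ext p
  simp only [feasible, Set.mem_ofPred_eq, Set.mem_inter_iff, Set.mem_prod, Set.mem_univ_pi,
    and_assoc]

lemma feasible_nonempty {P : X → ℝ} {W : X → Y → ℝ} (hP : P ∈ stdSimplex ℝ X)
    (hW : ∀ x, W x ∈ stdSimplex ℝ Y) : (feasible P W).Nonempty := by
  classical
  have hpos : ∀ {Z : Type _} [Fintype Z] {p : Z → ℝ}, p ∈ stdSimplex ℝ Z → ∃ z, p z ≠ 0 := by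
    intro Z _ p hp
    by_contra h
    push Not at h
    simpa [h] using hp.2
  obtain ⟨x₀, hx⟩ := hpos hP
  obtain ⟨y₀, hy⟩ : ∃ y, W x₀ y ≠ 0 := by
    by_contra h
    push Not at h
    simpa [h] using (hW x₀).2
  refine ⟨(Pi.single y₀ 1, fun _ => Pi.single x₀ 1), single_mem_stdSimplex ℝ y₀,
    fun _ => single_mem_stdSimplex ℝ x₀, fun y x h => ?_⟩
  by_cases h1 : y = y₀
  · by_cases h2 : x = x₀
    · subst h1 h2
      exact absurd h (mul_ne_zero hx hy)
    · simp [h2]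
  · simp [h1]

/-- Displays the continuous function v log v in place of a logarithm singular at v = 0. For c = 0
the conventions v/0 = 0 and log 0 = 0 give 0, so `realObjective` is continuous everywhere, not only
on `feasible`. -/
lemma mul_mul_log_div (t v c : ℝ) :
    t * v * Real.log (v / c) = if c = 0 then 0 else t * (v * Real.log v) - t * v * Real.log c := by
  split_ifs with hc
  · simp [hc]
  · by_cases hv : v = 0
    · simp [hv]
    · rw [Real.log_div hv hc]; ring

lemma continuous_realObjective (P : X → ℝ) (W : X → Y → ℝ) (R K : ℝ) :
    Continuous (fun p : (Y → ℝ) × (Y → X → ℝ) => realObjective P W R K p.1 p.2) := by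
  have hlog := Real.continuous_mul_log
  have h1 : Continuous fun p : (Y → ℝ) × (Y → X → ℝ) =>
      jointMean p.1 p.2 (llrJoint P W p.1 p.2) := by
    refine continuous_finsetSum _ fun y _ => continuous_finsetSum _ fun x _ => ?_
    have e : ∀ p : (Y → ℝ) × (Y → X → ℝ),
        p.1 y * p.2 y x * llrJoint P W p.1 p.2 x y = if P x * W x y = 0 then 0 else
          1 * (p.1 y * p.2 y x * Real.log (p.1 y * p.2 y x))
            - 1 * (p.1 y * p.2 y x) * Real.log (P x * W x y) := fun p => by
      rw [← mul_mul_log_div, one_mul]; rfl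
    simp only [e]
    split_ifs
    · exact continuous_const
    · have : Continuous fun p : (Y → ℝ) × (Y → X → ℝ) => p.1 y * p.2 y x := by fun_prop
      exact (continuous_const.mul (hlog.comp this)).sub ((continuous_const.mul this).mul
        continuous_const)
  have h2 : Continuous fun p : (Y → ℝ) × (Y → X → ℝ) => jointMean p.1 p.2 (llrCond P p.2) := by
    refine continuous_finsetSum _ fun y _ => continuous_finsetSum _ fun x _ => ?_
    simp only [llrCond, mul_mul_log_div]
    split_ifs
    · exact continuous_const
    · have h3 : Continuous fun p : (Y → ℝ) × (Y → X → ℝ) => p.2 y x := by fun_prop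
      have h4 : Continuous fun p : (Y → ℝ) × (Y → X → ℝ) => p.1 y := by fun_prop
      exact (h4.mul (hlog.comp h3)).sub ((h4.mul h3).mul continuous_const)
  have h3 : Continuous fun p : (Y → ℝ) × (Y → X → ℝ) =>
      jointMean p.1 p.2 (fun x y => -Real.log (W x y)) := by
    unfold jointMean
    fun_prop
  exact h1.add (continuous_const.max ((h2.sub continuous_const).add
    (continuous_const.max (h3.sub continuous_const))))

/-- The minimum defining the exponent is attained at some `TV ≪ PW`. -/
theorem exists_minimizer {P : X → ℝ} {W : X → Y → ℝ} (hP : P ∈ stdSimplex ℝ X)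
    (hW : ∀ x, W x ∈ stdSimplex ℝ Y) (R K : ℝ) :
    ∃ p ∈ feasible P W, (∀ q ∈ feasible P W,
      realObjective P W R K p.1 p.2 ≤ realObjective P W R K q.1 q.2) ∧
      errorExponent P W R K = (realObjective P W R K p.1 p.2 : EReal) ∧
      errorExponent P W R K ∈ objectiveValues P W R K := by
  obtain ⟨p, hp, hmin⟩ := (isCompact_feasible P W).exists_isMinOn (feasible_nonempty hP hW)
    (continuous_realObjective P W R K).continuousOn
  have hmem : (realObjective P W R K p.1 p.2 : EReal) ∈ objectiveValues P W R K :=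
    ⟨p.1, hp.1, p.2, hp.2.1, (objective_eq_coe R K hp.2.2).symm⟩
  have heq : errorExponent P W R K = (realObjective P W R K p.1 p.2 : EReal) := by
    refine le_antisymm (sInf_le hmem) (le_sInf ?_)
    rintro _ ⟨T, hT, V, hV, rfl⟩
    by_cases hac : ∀ y x, P x * W x y = 0 → T y * V y x = 0
    · rw [objective_eq_coe R K hac]
      exact EReal.coe_le_coe_iff.2 (hmin (show (T, V) ∈ feasible P W from ⟨hT, hV, hac⟩))
    · rw [objective_eq_top R K hac]
      exact le_top
  exact ⟨p, hp, fun q hq => hmin hq, heq, heq ▸ hmem⟩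

lemma tendsto_log_pow_div (d : ℕ) :
    Tendsto (fun n : ℕ => Real.log ((((n + 1 : ℕ) : ℝ) ^ d) ^ 2) / n) atTop (𝓝 0) := by
  have h : Tendsto (fun n : ℕ => Real.log (n : ℝ) / n) atTop (𝓝 0) :=
    (Real.isLittleO_log_id_atTop.tendsto_div_nhds_zero).comp tendsto_natCast_atTop_atTop
  have h1 := (tendsto_add_atTop_iff_nat 1).2 h
  have h2 : Tendsto (fun n : ℕ => 1 + 1 / (n : ℝ)) atTop (𝓝 (1 + 0)) :=
    tendsto_const_nhds.add tendsto_one_div_atTop_nhds_zero_nat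
  have h3 := (h1.mul h2).const_mul (2 * d : ℝ)
  simp only [zero_mul, mul_zero] at h3
  refine h3.congr' ?_
  filter_upwards [eventually_gt_atTop 0] with n hn
  have hn' : (n : ℝ) ≠ 0 := by exact_mod_cast hn.ne'
  have hn1 : ((n + 1 : ℕ) : ℝ) ≠ 0 := by positivity
  rw [Real.log_pow, Real.log_pow]
  push_cast at hn1 ⊢
  field_simp

end

end

end CloudChannel

theorem theorem1 {X Y : Type*} [Fintype X] [Fintype Y] [DecidableEq Y]
    (P : X → ℝ) (hP : P ∈ stdSimplex ℝ X)
    (W : X → Y → ℝ) (hW : ∀ x, W x ∈ stdSimplex ℝ Y)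
    (R K : ℝ) (hR : 0 < R) (hK : 0 < K)
    (δ : ∀ n : ℕ,
      CloudChannel.Decoder X Y n (CloudChannel.expSize n R) (CloudChannel.expSize n K))
    (hδ : ∀ n, CloudChannel.IsMLDecoder (δ n)) :
    -- the infimum that defines the exponent is a minimum, and it is finite
    CloudChannel.errorExponent P W R K ∈ CloudChannel.objectiveValues P W R K ∧
    CloudChannel.errorExponent P W R K ≠ ⊤ ∧
    -- the average error probability is eventually positive and has this exponent
    (∀ᶠ n in atTop, 0 < CloudChannel.avgError P W (δ n)) ∧
    Tendsto
      (fun n : ℕ =>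
        ((-(1 / (n : ℝ)) * Real.log (CloudChannel.avgError P W (δ n)) : ℝ) : EReal))
      atTop (𝓝 (CloudChannel.errorExponent P W R K)) := by
  obtain ⟨p, hp, hmin, heq, hmem⟩ := CloudChannel.exists_minimizer hP hW R K
  set e := CloudChannel.realObjective P W R K p.1 p.2 with he
  have hlow : ∀ ε > 0, ∀ᶠ n : ℕ in atTop,
      1 / 208 * Real.exp (-(n * (e + 4 * ε))) ≤ CloudChannel.avgError P W (δ n) := by
    intro ε hε
    filter_upwards [CloudChannel.eventually_half_le_mean_typicalInd P W hp.1 hp.2.1 hε,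
      (tendsto_natCast_atTop_atTop.atTop_mul_const hR).eventually_ge_atTop 1] with n htyp hnR
    exact CloudChannel.avgError_ge hP hW hR hK hp.1 hp.2.1 hp.2.2 hnR hε.le htyp (hδ n)
  have hpos : ∀ᶠ n in atTop, 0 < CloudChannel.avgError P W (δ n) :=
    (hlow 1 one_pos).mono fun n hn => lt_of_lt_of_le (by positivity) hn
  refine ⟨hmem, by rw [heq]; exact EReal.coe_ne_top e, hpos, ?_⟩
  rw [heq]
  refine (continuous_coe_real_ereal.tendsto e).comp ?_
  have hup := CloudChannel.tendsto_log_pow_div (Fintype.card Y * Fintype.card X)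
  have hconst : Tendsto (fun n : ℕ => Real.log 208 / (n : ℝ)) atTop (𝓝 0) :=
    tendsto_const_div_atTop_nhds_zero_nat _
  refine tendsto_order.2 ⟨fun a ha => ?_, fun a ha => ?_⟩
  · filter_upwards [hpos, eventually_gt_atTop 0, hup.eventually_lt_const (sub_pos.2 ha)]
      with n hn0 hn hlt
    have hn' : (0 : ℝ) < n := by exact_mod_cast hn
    have hle := CloudChannel.avgError_le hP hW hR hK hn (hδ n) (e := e)
      fun T hT V hV hac => hmin (T, V) ⟨hT, hV, hac⟩
    have hlog := Real.log_le_log hn0 hle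
    rw [Real.log_mul (by positivity) (Real.exp_pos _).ne', Real.log_exp] at hlog
    rw [div_lt_iff₀ hn'] at hlt
    rw [neg_mul, one_div_mul_eq_div, ← neg_div, lt_div_iff₀ hn']
    linarith
  -- With ε = (a − e)/8 the slack 4ε uses half of the gap a − e; the constant 208 uses less than the
  -- other half.
  · filter_upwards [hpos, eventually_gt_atTop 0, hlow ((a - e) / 8) (by linarith),
      hconst.eventually_lt_const (half_pos (sub_pos.2 ha))] with n hn0 hn hle hlt
    have hn' : (0 : ℝ) < n := by exact_mod_cast hn
    have hlog := Real.log_le_log (by positivity) hle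
    rw [Real.log_mul (by norm_num) (Real.exp_pos _).ne', Real.log_exp, one_div, Real.log_inv] at hlog
    rw [div_lt_iff₀ hn'] at hlt
    rw [neg_mul, one_div_mul_eq_div, ← neg_div, div_lt_iff₀ hn']
    linarith
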